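/- **Setting.** Fix an integer $k\ge 2$, a finite non-empty set $\Omega$, a finite set $\Psi$ of weight functions $\psi:\Omega^k\to(0,2)$ with a prior distribution $p$ on $\Psi$, and a probability distribution $D$ on $\{0,\dots,\Delta\}$. Let $n\ge 1$ be such that a *$D$-partition* of $[n]$ exists, i.e. a degree sequence $d:[n]\to\{0,\dots,\Delta\}$ with $|\{x: d(x)=l\}|=nD(l)$ for all $l$, and let $\boldsymbol d$ be a uniformly random $D$-partition. A graph is a list of check nodes $a$, in the order of creation, each with a neighbourhood $\partial a\in[n]^k$. For $\delta:[n]\to\mathbb N$, $\delta\ne0$, let $\nu_\delta(x)=\delta(x)/\sum_y\delta(y)$. *Configuration model from $\delta$.* Neighbours are drawn one after the other from $\nu_\delta$, where $\delta(x)$ is reduced by one each time $x$ is drawn; each block of $k$ successive draws is the neighbourhood of a new check node. The $(D,k)$-graph has $M=\lfloor k^{-1}\sum_x \boldsymbol d(x)\rfloor$ check nodes generated in this way from $\delta=\boldsymbol d$. *Layered multi-Poisson $(\alpha,\beta)$-approximation.* Let $s_{\max}=\lfloor(1-\alpha)\beta^{-1}k^{-1}\sum_x\boldsymbol d(x)\rfloor$,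 let $\boldsymbol m_1,\dots,\boldsymbol m_{s_{\max}}$ be independent ${\rm Po}(\beta)$ variables, and $\delta_1=\boldsymbol d$. In layer $s=1,\dots,s_{\max}$ add $\boldsymbol m_s$ check nodes with neighbourhoods drawn independently from $\nu_{\delta_s}^{\otimes k}$, and then put $\delta_{s+1}=\max(\delta_s-\nabla_s,0)$, where $\nabla_s(x)$ is the number of times $x$ was drawn in layer $s$. (If the residual degrees are exhausted, uniform draws are used by convention.) The *missing check nodes* are $\max(M-N,0)$ further check nodes, $N$ being the number of check nodes of the approximation, generated by the configuration model from $\delta_{s_{\max}+1}$. *Weights.* Let $\boldsymbol\sigma^*\in\Omega^n$ be uniformly random and independent of the graph. Given $\boldsymbol\sigma^*$ and the graph, independently every check node $a$ with neighbours $\partial_1a\le\dots\le\partial_ka$ in ascending order receives the weight function $\psi$ with probability proportional to $p(\psi)\psi(\boldsymbol\sigma^*(\partial_1a),\dots,\boldsymbol\sigma^*(\partial_ka))$. Write $\boldsymbol G^*_{D}$ and $\boldsymbol G^*_{\alpha,\beta,D}$ for the resulting weighted graphs over the $(D,k)$-graph and over the approximation; missing check nodes of the latter receive weights in the same way. **Proposition.**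 There are a function $f:(0,1)\times(0,\infty)\to\mathbb R$, bounded on $[\varepsilon,1)\times(0,B]$ for all $\varepsilon,B>0$, and a constant $C$, neither depending on $n$ (and $C$ not depending on $\alpha,\beta$ either), such that for all $\alpha\in(0,1)$ and $\beta>0$: 1. For every $n$ as above there is a coupling of $\boldsymbol G^*_{\alpha,\beta,D}$, its missing check nodes, and $\boldsymbol G^*_D$, such that, once the missing check nodes have been appended to $\boldsymbol G^*_{\alpha,\beta,D}$, the expected number of check nodes with different neighbourhoods in the two graphs is at most $f(\alpha,\beta)$. Here the $i$-th check nodes are compared with each other, and a check node present in only one of the graphs counts as different. 2. The number of missing check nodes is $O(\alpha n)$: for all sufficiently large $n$ as above (depending on $\alpha,\beta$) its expectation is at most $C\alpha n$, and the probability that it exceeds $C\alpha n$ tends to $0$ as $n\to\infty$ through such $n$. -/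

import Mathlib

open scoped ENNReal NNReal

noncomputable section

namespace FactorGraph

/-! ### Generic tools -/

/-- `j` independent samples from `μ`. -/
def iid {γ : Type*} (μ : PMF γ) : (j : ℕ) → PMF (Fin j → γ)
  | 0 => PMF.pure Fin.elim0
  | j + 1 => μ.bind fun a => (iid μ j).bind fun v => PMF.pure (Fin.cons a v)

/-- The expectation of a nonnegative (possibly infinite) quantity under a discrete law. -/
def expect {γ : Type*} (μ : PMF γ) (g : γ → ℝ≥0∞) : ℝ≥0∞ := ∑' x, μ x * g x

/-- The Poisson distribution as a discrete law on `ℕ`, `j ↦ e^{-r} r^j / j!`. -/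
def poisson (r : ℝ≥0) : PMF ℕ := (ProbabilityTheory.poissonMeasure r).toPMF

theorem poisson_apply (r : ℝ≥0) (j : ℕ) :
    poisson r j = ENNReal.ofReal (Real.exp (-r) * (r : ℝ) ^ j / j.factorial) := by
  rw [poisson, MeasureTheory.Measure.toPMF_apply, ProbabilityTheory.poissonMeasure_singleton]

/-! ### Random neighbourhoods

A check node of an unweighted graph on the variable nodes `Fin n` is its neighbourhood
`Fin k → Fin n`; a graph is the list of its check nodes in the order of their creation. -/

section Unweighted

variable {n : ℕ} [NeZero n]

/-- The distribution `ν` on the variable nodes proportional to the residual degrees `δ`. If no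
residual degree is left (where the generation of the approximate graph is considered to have
failed) the uniform distribution is used, by convention. -/
def socketLaw (δ : Fin n → ℕ) : PMF (Fin n) :=
  if h : ∑ x, δ x = 0 then PMF.uniformOfFintype (Fin n)
  else PMF.normalize (fun x => (δ x : ℝ≥0∞))
    (by rw [tsum_fintype]; exact_mod_cast h)
    (by rw [tsum_fintype]; exact_mod_cast ENNReal.natCast_ne_top _)

/-- Draw `j` sockets one after the other, updating the residual degrees after every draw.
Returns the drawn variable nodes and the final residual degrees. -/
def drawUpdating : (j : ℕ) → (Fin n → ℕ) → PMF ((Fin j → Fin n) × (Fin n → ℕ))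
  | 0, δ => PMF.pure (Fin.elim0, δ)
  | j + 1, δ => (socketLaw δ).bind fun x =>
      (drawUpdating j (fun y => δ y - if y = x then 1 else 0)).bind fun q =>
        PMF.pure (Fin.cons x q.1, q.2)

/-- Generate `r` check nodes by the configuration model, from the residual degrees `δ`. -/
def configChecks (k : ℕ) : (r : ℕ) → (Fin n → ℕ) → PMF (List (Fin k → Fin n))
  | 0, _ => PMF.pure []
  | r + 1, δ => (drawUpdating k δ).bind fun q =>
      (configChecks k r q.2).bind fun F => PMF.pure (q.1 :: F)

/-- The number of check nodes of the configuration model: as many as the sockets allow. -/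
def numChecks (k : ℕ) (d : Fin n → ℕ) : ℕ := (∑ x, d x) / k

/-- The configuration model with degree sequence `d`. -/
def configModel (k : ℕ) (d : Fin n → ℕ) : PMF (List (Fin k → Fin n)) :=
  configChecks k (numChecks k d) d

/-- The number of times that `x` occurs as a neighbour in the check nodes `a`. -/
def multiplicity {m k : ℕ} (a : Fin m → Fin k → Fin n) (x : Fin n) : ℕ :=
  (Finset.univ.filter fun ij : Fin m × Fin k => a ij.1 ij.2 = x).card

/-- The layered graph with layer sizes `m`: in every layer all neighbours are drawn independently
from `ν ∝ δ`, and only after the layer is complete `δ` is replaced by `(δ - ∇)₊`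
(truncated subtraction). Returns the graph and the final residual degrees. -/
def layeredGraph (k : ℕ) : (m : List ℕ) → (Fin n → ℕ) →
    PMF (List (Fin k → Fin n) × (Fin n → ℕ))
  | [], δ => PMF.pure ([], δ)
  | m :: ms, δ => (iid (iid (socketLaw δ) k) m).bind fun a =>
      (layeredGraph k ms (fun x => δ x - multiplicity a x)).bind fun q =>
        PMF.pure (List.ofFn a ++ q.1, q.2)

/-- The number of layers, `⌊(1 - α) β⁻¹ k⁻¹ ∑ₓ d(x)⌋`. -/
def numLayers (k : ℕ) (α β : ℝ) (d : Fin n → ℕ) : ℕ :=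
  ⌊(1 - α) * β⁻¹ * (k : ℝ)⁻¹ * ((∑ x, d x : ℕ) : ℝ)⌋₊

/-- The `(α, β)`-approximation: layers of independent `Po(β)` sizes. -/
def multiPoisson (k : ℕ) (α β : ℝ) (d : Fin n → ℕ) :
    PMF (List (Fin k → Fin n) × (Fin n → ℕ)) :=
  (iid (poisson β.toNNReal) (numLayers k α β d)).bind fun m => layeredGraph k (List.ofFn m) d

/-- The missing check nodes of the graph `q.1` with residual degrees `q.2`: check nodes are
generated by the configuration model from the residual degrees until there are as many as in the
configuration model with degree sequence `d`. -/
def missingChecks (k : ℕ) (d : Fin n → ℕ) (q : List (Fin k → Fin n) × (Fin n → ℕ)) :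
    PMF (List (Fin k → Fin n)) :=
  configChecks k (numChecks k d - q.1.length) q.2

/-! ### Random degree sequences -/

/-- The degree sequences `d` on `n` variable nodes in which exactly `n D(l)` nodes have degree `l`,
for every `l`. Here `D` is a degree distribution on `{0, …, Δ}`. -/
def degreeSequences {Δ : ℕ} (D : PMF (Fin (Δ + 1))) (n : ℕ) : Finset (Fin n → Fin (Δ + 1)) :=
  open Classical in
  Finset.univ.filter fun d =>
    ∀ l, ((Finset.univ.filter fun x => d x = l).card : ℝ≥0∞) = n * D l

/-- A uniformly random `D`-partition of the variable nodes, as a degree sequence. -/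
def degreeLaw {Δ : ℕ} (D : PMF (Fin (Δ + 1))) (h : (degreeSequences D n).Nonempty) :
    PMF (Fin n → ℕ) :=
  (PMF.uniformOfFinset (degreeSequences D n) h).map fun d x => (d x : ℕ)

end Unweighted

/-! ### The teacher-student model -/

/-- A finite set `Ψ` of weight functions `ψ : Ω^k → (0, 2)` together with a prior on it. -/
structure WeightModel (Ω : Type*) (k : ℕ) where
  /-- the weight functions -/
  Ψ : Finset ((Fin k → Ω) → ℝ)
  pos : ∀ ψ ∈ Ψ, ∀ τ, 0 < ψ τ
  lt_two : ∀ ψ ∈ Ψ, ∀ τ, ψ τ < 2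
  /-- the prior distribution on the weight functions -/
  prior : PMF Ψ

section Weighted

variable {Ω : Type*} {k n : ℕ}

/-- The neighbours `(∂₁a, …, ∂ₖa)` in ascending order. -/
def ascending (a : Fin k → Fin n) : Fin k → Fin n := a ∘ Tuple.sort a

/-- A weighted check node: its neighbourhood and its weight function. -/
abbrev CheckNode (W : WeightModel Ω k) (n : ℕ) := (Fin k → Fin n) × W.Ψ

/-- The law of the weight function of a check node with neighbourhood `a` under the ground truth
`σ`: the probability of `ψ` is proportional to `p(ψ) ψ(σ(∂₁a), …, σ(∂ₖa))`. -/
def weightLaw (W : WeightModel Ω k) (σ : Fin n → Ω) (a : Fin k → Fin n) : PMF W.Ψ :=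
  PMF.normalize (fun ψ => W.prior ψ * ENNReal.ofReal (ψ.1 (σ ∘ ascending a)))
    (by
      obtain ⟨ψ, hψ⟩ := W.prior.support_nonempty
      intro h
      have := ENNReal.tsum_eq_zero.1 h ψ
      rw [mul_eq_zero] at this
      rcases this with h | h
      · exact (W.prior.mem_support_iff ψ).1 hψ h
      · exact absurd (ENNReal.ofReal_eq_zero.1 h) (not_le.2 (W.pos _ ψ.2 _)))
    (by
      rw [tsum_fintype]
      exact ENNReal.sum_ne_top.2 fun ψ _ =>
        ENNReal.mul_ne_top (W.prior.apply_ne_top ψ) ENNReal.ofReal_ne_top)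

/-- Attach independent random weight functions to all check nodes. -/
def attachWeights (W : WeightModel Ω k) (σ : Fin n → Ω) :
    List (Fin k → Fin n) → PMF (List (CheckNode W n))
  | [] => PMF.pure []
  | a :: F => (weightLaw W σ a).bind fun ψ =>
      (attachWeights W σ F).bind fun G => PMF.pure ((a, ψ) :: G)

variable [Fintype Ω] [Nonempty Ω] [NeZero n] {Δ : ℕ}

/-- The law of the teacher-student graph over the configuration model with a uniformly random
`D`-partition as degree sequence. -/
def exactGraph (W : WeightModel Ω k) (D : PMF (Fin (Δ + 1)))
    (h : (degreeSequences D n).Nonempty) : PMF (List (CheckNode W n)) :=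
  (PMF.uniformOfFintype (Fin n → Ω)).bind fun σ =>
    (degreeLaw D h).bind fun d =>
      (configModel k d).bind fun F => attachWeights W σ F

/-- The law of the teacher-student graph over the layered multi-Poisson
`(α, β)`-approximation. -/
def approxGraph (W : WeightModel Ω k) (D : PMF (Fin (Δ + 1)))
    (h : (degreeSequences D n).Nonempty) (α β : ℝ) : PMF (List (CheckNode W n)) :=
  (PMF.uniformOfFintype (Fin n → Ω)).bind fun σ =>
    (degreeLaw D h).bind fun d =>
      (multiPoisson k α β d).bind fun q => attachWeights W σ q.1

/-- The joint law of the layered multi-Poisson teacher-student graph and its missing check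
nodes. -/
def approxGraphWithMissing (W : WeightModel Ω k) (D : PMF (Fin (Δ + 1)))
    (h : (degreeSequences D n).Nonempty) (α β : ℝ) :
    PMF (List (CheckNode W n) × List (CheckNode W n)) :=
  (PMF.uniformOfFintype (Fin n → Ω)).bind fun σ =>
    (degreeLaw D h).bind fun d =>
      (multiPoisson k α β d).bind fun q =>
        (attachWeights W σ q.1).bind fun G =>
          (missingChecks k d q).bind fun A =>
            (attachWeights W σ A).bind fun B => PMF.pure (G, B)

/-- Forgetting the missing check nodes gives back the approximation. -/
theorem map_fst_approxGraphWithMissing (W : WeightModel Ω k) (D : PMF (Fin (Δ + 1)))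
    (h : (degreeSequences D n).Nonempty) (α β : ℝ) :
    (approxGraphWithMissing W D h α β).map Prod.fst = approxGraph W D h α β := by
  simp [approxGraphWithMissing, approxGraph, PMF.map_bind, PMF.pure_map, PMF.bind_const,
    PMF.bind_pure]

/-- The number of check nodes that have different neighbourhoods in the two graphs, where the
`i`-th check node of one graph is compared with the `i`-th of the other; a check node that is
present in only one of the graphs counts as different. -/
def numDifferent {W : WeightModel Ω k} (G G' : List (CheckNode W n)) : ℕ :=
  ((Finset.range (max G.length G'.length)).filter fun i =>
    (G[i]?).map Prod.fst ≠ (G'[i]?).map Prod.fst).card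

end Weighted

end FactorGraph

end

/-! Let S be the sum of the degrees, T = S/k, M the number of check nodes of the configuration model
and N that of the approximation. A layer of m check nodes makes mk draws with replacement where the
configuration model draws without. While at least b sockets are left, both can be coupled with at
most (mk)²/b differing draws in expectation (`coupled_drawList_iidList`). The differences perturb
the residual degrees, but the configuration model is stable: by exchangeability, one additional
socket changes at most one draw in expectation (`coupled_drawList_add_single`). Replacing one layer
thus costs at most 3(mk)²/b (`coupled_layer`), and the costs of the layers add up
(`coupled_completedGraph`).

N has mean and variance sβ ≤ (1-α)T, s being the number of layers. If αS/2 sockets survive, take b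
about αS/2: since E[m²] = β + β² and sβ ≤ T, the expected cost is of order k(1+β)/α, uniformly in n.
Otherwise N exceeds its mean by αT/2, and the trivial cost N + 2M, weighted as in Chebyshev's
inequality, contributes only 2/α + 12/α² (`coupled_multiPoisson`).

The same variance bound controls the missing check nodes: M - N is at most αT + β plus the deviation
of N from its mean (`missing_le`). The weights are harmless, as only neighbourhoods are compared. -/

noncomputable section

namespace FactorGraph

/-! ### Expectations -/

section Expect

variable {γ γ' : Type*}

theorem expect_mono_support {μ : PMF γ} {g h : γ → ℝ≥0∞} (H : ∀ x ∈ μ.support, g x ≤ h x) :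
    expect μ g ≤ expect μ h := by
  refine ENNReal.tsum_le_tsum fun x => ?_
  by_cases hx : x ∈ μ.support
  · exact mul_le_mul_right (H x hx) _
  · rw [PMF.mem_support_iff, not_not] at hx
    simp [hx]

theorem expect_congr_support {μ : PMF γ} {g h : γ → ℝ≥0∞} (H : ∀ x ∈ μ.support, g x = h x) :
    expect μ g = expect μ h :=
  le_antisymm (expect_mono_support fun x hx => (H x hx).le)
    (expect_mono_support fun x hx => (H x hx).ge)

theorem expect_mono {μ : PMF γ} {g h : γ → ℝ≥0∞} (H : ∀ x, g x ≤ h x) :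
    expect μ g ≤ expect μ h :=
  expect_mono_support fun x _ => H x

@[simp]
theorem expect_const (μ : PMF γ) (C : ℝ≥0∞) : expect μ (fun _ => C) = C := by
  simp [expect, ENNReal.tsum_mul_right]

theorem expect_add (μ : PMF γ) (g h : γ → ℝ≥0∞) :
    expect μ (fun x => g x + h x) = expect μ g + expect μ h := by
  simp [expect, mul_add, ENNReal.tsum_add]

theorem expect_const_mul (μ : PMF γ) (C : ℝ≥0∞) (g : γ → ℝ≥0∞) :
    expect μ (fun x => C * g x) = C * expect μ g := by
  simp only [expect, ← ENNReal.tsum_mul_left]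
  exact tsum_congr fun x => by ring

@[simp]
theorem expect_pure (x : γ) (g : γ → ℝ≥0∞) : expect (PMF.pure x) g = g x := by
  classical
  rw [expect, tsum_eq_single x]
  · simp
  · intro y hy
    simp [PMF.pure_apply, hy]

@[simp]
theorem expect_bind (μ : PMF γ) (K : γ → PMF γ') (g : γ' → ℝ≥0∞) :
    expect (μ.bind K) g = expect μ fun x => expect (K x) g := by
  simp only [expect, PMF.bind_apply, ← ENNReal.tsum_mul_right, ← ENNReal.tsum_mul_left]
  rw [ENNReal.tsum_comm]
  exact tsum_congr fun x => tsum_congr fun y => by ring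

@[simp]
theorem expect_map (μ : PMF γ) (f : γ → γ') (g : γ' → ℝ≥0∞) :
    expect (μ.map f) g = expect μ fun x => g (f x) := by
  rw [← PMF.bind_pure_comp, expect_bind]
  simp

theorem expect_le_of_support {μ : PMF γ} {g : γ → ℝ≥0∞} {C : ℝ≥0∞}
    (H : ∀ x ∈ μ.support, g x ≤ C) : expect μ g ≤ C :=
  (expect_mono_support H).trans (expect_const μ C).le

theorem toOuterMeasure_eq_expect (μ : PMF γ) (s : Set γ) :
    μ.toOuterMeasure s = expect μ (s.indicator 1) := by
  classical
  rw [PMF.toOuterMeasure_apply]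
  refine tsum_congr fun x => ?_
  by_cases hx : x ∈ s <;> simp [hx]

end Expect

/-! ### Couplings -/

section Coupled

variable {γ γ' γ'' θ θ' : Type*}

theorem map_fun_const (μ : PMF γ) (y : γ') : μ.map (fun _ => y) = PMF.pure y :=
  PMF.map_const μ y

theorem bind_congr_support {μ : PMF γ} {K K' : γ → PMF γ'} (H : ∀ x ∈ μ.support, K x = K' x) :
    μ.bind K = μ.bind K' := by
  ext y
  simp only [PMF.bind_apply]
  refine tsum_congr fun x => ?_
  by_cases hx : x ∈ μ.support
  · rw [H x hx]
  · rw [PMF.mem_support_iff, not_not] at hx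
    simp [hx]

/-- Disintegration of a discrete law along a map. -/
theorem exists_disintegration (μ : PMF γ) (f : γ → γ') :
    ∃ κ : γ' → PMF γ, (μ.map f).bind κ = μ ∧
      ∀ y ∈ (μ.map f).support, ∀ x ∈ (κ y).support, f x = y := by
  classical
  have key : ∀ y ∈ (μ.map f).support, ∃ x ∈ f ⁻¹' {y}, x ∈ μ.support := by
    intro y hy
    rw [PMF.mem_support_map_iff] at hy
    obtain ⟨x, hx, rfl⟩ := hy
    exact ⟨x, rfl, hx⟩
  -- The kernel is `μ` conditioned on the fibre of `y`; off the support its value is arbitrary.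
  refine ⟨fun y => if h : y ∈ (μ.map f).support then μ.filter (f ⁻¹' {y}) (key y h) else μ,
    ?_, ?_⟩
  · ext x
    rw [PMF.bind_apply, tsum_eq_single (f x)]
    · by_cases hx : μ x = 0
      · rw [hx]
        split_ifs with h
        · simp [PMF.filter_apply, hx]
        · simp [hx]
      · have h : f x ∈ (μ.map f).support := by
          rw [PMF.mem_support_map_iff]
          exact ⟨x, hx, rfl⟩
        have e : (μ.map f) (f x) = ∑' z, (f ⁻¹' {f x}).indicator (⇑μ) z := by
          rw [PMF.map_apply]
          refine tsum_congr fun z => ?_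
          by_cases hz : f x = f z
          · simp [Set.indicator, hz]
          · simp [Set.indicator, hz, eq_comm]
        rw [dif_pos h, PMF.filter_apply, ← e, Set.indicator_of_mem (by simp), mul_comm, mul_assoc,
          ENNReal.inv_mul_cancel h (PMF.apply_ne_top _ _), mul_one]
    · intro y hy
      by_cases h : y ∈ (μ.map f).support
      · rw [dif_pos h, PMF.filter_apply, Set.indicator_of_notMem]
        · simp
        · simpa using hy.symm
      · rw [PMF.mem_support_iff, not_not] at h
        simp [h]
  · intro y hy x hx
    beta_reduce at hx
    rw [dif_pos hy, PMF.mem_support_filter_iff] at hx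
    simpa using hx.1

/-- The laws `μ` and `ν` have a coupling with expected cost at most `C`. -/
def Coupled (c : γ → γ' → ℝ≥0∞) (μ : PMF γ) (ν : PMF γ') (C : ℝ≥0∞) : Prop :=
  ∃ π : PMF (γ × γ'), π.map Prod.fst = μ ∧ π.map Prod.snd = ν ∧
    expect π (fun p => c p.1 p.2) ≤ C

theorem Coupled.mono {c : γ → γ' → ℝ≥0∞} {μ : PMF γ} {ν : PMF γ'} {C C' : ℝ≥0∞}
    (h : Coupled c μ ν C) (hC : C ≤ C') : Coupled c μ ν C' := by
  obtain ⟨π, h1, h2, h3⟩ := h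
  exact ⟨π, h1, h2, h3.trans hC⟩

theorem Coupled.mono_cost {c c' : γ → γ' → ℝ≥0∞} {μ : PMF γ} {ν : PMF γ'} {C : ℝ≥0∞}
    (h : Coupled c μ ν C) (hc : ∀ x ∈ μ.support, ∀ y ∈ ν.support, c' x y ≤ c x y) :
    Coupled c' μ ν C := by
  obtain ⟨π, rfl, rfl, h3⟩ := h
  refine ⟨π, rfl, rfl, (expect_mono_support fun p hp => ?_).trans h3⟩
  exact hc _ ((PMF.mem_support_map_iff _ _ _).2 ⟨p, hp, rfl⟩)
    _ ((PMF.mem_support_map_iff _ _ _).2 ⟨p, hp, rfl⟩)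

/-- The cost of the first stage acts as a budget: a pair `(x, y)` grants the second stage the cost
`c x y`, and the average budget is at most `C`. -/
theorem Coupled.bind {c : γ → γ' → ℝ≥0∞} {c' : θ → θ' → ℝ≥0∞} {μ : PMF γ} {ν : PMF γ'}
    {C : ℝ≥0∞} {K : γ → PMF θ} {K' : γ' → PMF θ'} (h : Coupled c μ ν C)
    (H : ∀ x ∈ μ.support, ∀ y ∈ ν.support, Coupled c' (K x) (K' y) (c x y)) :
    Coupled c' (μ.bind K) (ν.bind K') C := by
  classical
  obtain ⟨π, rfl, rfl, h3⟩ := h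
  have H' : ∀ p ∈ π.support, Coupled c' (K p.1) (K' p.2) (c p.1 p.2) := fun p hp =>
    H _ ((PMF.mem_support_map_iff _ _ _).2 ⟨p, hp, rfl⟩)
      _ ((PMF.mem_support_map_iff _ _ _).2 ⟨p, hp, rfl⟩)
  obtain ⟨p₀, hp₀⟩ := π.support_nonempty
  -- `choose!` needs a default coupling for pairs outside the support.
  have : Nonempty (PMF (θ × θ')) := ⟨(H' p₀ hp₀).choose⟩
  choose! κ h4 h5 h6 using H'
  refine ⟨π.bind κ, ?_, ?_, ?_⟩
  · rw [PMF.map_bind, PMF.bind_map]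
    exact bind_congr_support h4
  · rw [PMF.map_bind, PMF.bind_map]
    exact bind_congr_support h5
  · rw [expect_bind]
    exact (expect_mono_support h6).trans h3

theorem Coupled.bind_same {c' : θ → θ' → ℝ≥0∞} {μ : PMF γ} {g : γ → ℝ≥0∞}
    {C : ℝ≥0∞} {K : γ → PMF θ} {K' : γ → PMF θ'} (hC : expect μ g ≤ C)
    (H : ∀ x ∈ μ.support, Coupled c' (K x) (K' x) (g x)) :
    Coupled c' (μ.bind K) (μ.bind K') C := by
  obtain ⟨x₀, hx₀⟩ := μ.support_nonempty
  have : Nonempty (PMF (θ × θ')) := ⟨(H x₀ hx₀).choose⟩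
  choose! κ h4 h5 h6 using H
  refine ⟨μ.bind κ, ?_, ?_, ?_⟩
  · rw [PMF.map_bind]
    exact bind_congr_support h4
  · rw [PMF.map_bind]
    exact bind_congr_support h5
  · rw [expect_bind]
    exact (expect_mono_support h6).trans hC

theorem Coupled.bind_same_const {c' : θ → θ' → ℝ≥0∞} {μ : PMF γ}
    {C : ℝ≥0∞} {K : γ → PMF θ} {K' : γ → PMF θ'}
    (H : ∀ x ∈ μ.support, Coupled c' (K x) (K' x) C) :
    Coupled c' (μ.bind K) (μ.bind K') C :=
  Coupled.bind_same (g := fun _ => C) (expect_const μ C).le H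

theorem coupled_pure {c : γ → γ' → ℝ≥0∞} {C : ℝ≥0∞} {x : γ} {y : γ'} (h : c x y ≤ C) :
    Coupled c (PMF.pure x) (PMF.pure y) C :=
  ⟨PMF.pure (x, y), by simp [PMF.pure_map], by simp [PMF.pure_map], by simpa using h⟩

theorem coupled_refl {c : γ → γ → ℝ≥0∞} {C : ℝ≥0∞} (μ : PMF γ) (h : ∀ x, c x x ≤ C) :
    Coupled c μ μ C := by
  have := Coupled.bind_same_const (c' := c) (μ := μ) (K := PMF.pure) (K' := PMF.pure) (C := C)
    fun x _ => coupled_pure (h x)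
  simpa using this

/-- The independent coupling. -/
theorem coupled_of_forall {c : γ → γ' → ℝ≥0∞} {C : ℝ≥0∞} (μ : PMF γ) (ν : PMF γ')
    (h : ∀ x ∈ μ.support, ∀ y ∈ ν.support, c x y ≤ C) : Coupled c μ ν C := by
  refine ⟨μ.bind fun x => ν.map fun y => (x, y), ?_, ?_, ?_⟩
  · simp [PMF.map_bind, PMF.map_comp, Function.comp_def, map_fun_const]
  · simp [PMF.map_bind, PMF.map_comp, Function.comp_def]
    exact PMF.map_id _
  · rw [expect_bind]
    refine expect_le_of_support fun x hx => ?_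
    rw [expect_map]
    exact expect_le_of_support fun y hy => h x hx y hy

theorem Coupled.symm {c : γ → γ' → ℝ≥0∞} {μ : PMF γ} {ν : PMF γ'} {C : ℝ≥0∞}
    (h : Coupled c μ ν C) : Coupled (fun y x => c x y) ν μ C := by
  obtain ⟨π, rfl, rfl, h3⟩ := h
  refine ⟨π.map Prod.swap, ?_, ?_, ?_⟩
  · simp [PMF.map_comp, Function.comp_def]
  · simp [PMF.map_comp, Function.comp_def]
  · simpa using h3

theorem Coupled.map {c : θ → θ' → ℝ≥0∞} {f : γ → θ} {g : γ' → θ'} {μ : PMF γ} {ν : PMF γ'}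
    {C : ℝ≥0∞} (h : Coupled (fun x y => c (f x) (g y)) μ ν C) :
    Coupled c (μ.map f) (ν.map g) C := by
  rw [← PMF.bind_pure_comp, ← PMF.bind_pure_comp]
  exact h.bind fun x _ y _ => coupled_pure le_rfl

/-- A coupling of the images lifts to a coupling. -/
theorem Coupled.of_map {c : θ → θ' → ℝ≥0∞} {f : γ → θ} {g : γ' → θ'} {μ : PMF γ} {ν : PMF γ'}
    {C : ℝ≥0∞} (h : Coupled c (μ.map f) (ν.map g) C) :
    Coupled (fun x y => c (f x) (g y)) μ ν C := by
  obtain ⟨κ, h1, h2⟩ := exists_disintegration μ f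
  obtain ⟨κ', h1', h2'⟩ := exists_disintegration ν g
  have := h.bind (K := κ) (K' := κ') (c' := fun x y => c (f x) (g y)) fun x hx y hy =>
    coupled_of_forall _ _ fun a ha b hb => by rw [h2 x hx a ha, h2' y hy b hb]
  rwa [h1, h1'] at this

/-- Gluing two couplings along the common marginal. -/
theorem Coupled.trans {c : γ → γ' → ℝ≥0∞} {c' : γ' → γ'' → ℝ≥0∞} {c'' : γ → γ'' → ℝ≥0∞}
    {μ : PMF γ} {ν : PMF γ'} {ρ : PMF γ''} {C C' : ℝ≥0∞} (h : Coupled c μ ν C)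
    (h' : Coupled c' ν ρ C') (H : ∀ x y z, c'' x z ≤ c x y + c' y z) :
    Coupled c'' μ ρ (C + C') := by
  obtain ⟨π, rfl, rfl, h3⟩ := h
  obtain ⟨π', h1, rfl, h3'⟩ := h'
  -- The third coordinate is resampled given the middle one, independently of the first.
  obtain ⟨κ, h4, h5⟩ := exists_disintegration π' Prod.fst
  rw [h1, PMF.bind_map] at h4
  have h6 : ∀ p ∈ π.support, ∀ q ∈ (κ p.2).support, q.1 = p.2 := fun p hp q hq =>
    h5 p.2 (by rw [h1, PMF.mem_support_map_iff]; exact ⟨p, hp, rfl⟩) q hq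
  refine ⟨π.bind fun p => (κ p.2).map fun q => (p.1, q.2), ?_, ?_, ?_⟩
  · simp only [PMF.map_bind, PMF.map_comp, Function.comp_def, map_fun_const]
    rw [← PMF.bind_pure_comp]
    rfl
  · conv_rhs => rw [← h4]
    simp only [PMF.map_bind, PMF.map_comp, Function.comp_def]
  · rw [expect_bind]
    simp only [expect_map]
    calc expect π (fun p => expect (κ p.2) fun q => c'' p.1 q.2)
        ≤ expect π (fun p => c p.1 p.2 + expect (κ p.2) fun q => c' q.1 q.2) := by
          refine expect_mono_support fun p hp => ?_
          rw [← expect_const (κ p.2) (c p.1 p.2), ← expect_add]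
          refine expect_mono_support fun q hq => ?_
          rw [h6 p hp q hq]
          exact H _ _ _
      _ ≤ C + C' := by
          rw [expect_add]
          refine add_le_add h3 ?_
          rw [← h4, expect_bind] at h3'
          exact h3'

end Coupled

/-! ### The number of differences of two lists -/

section ListDiff

open Classical in
/-- The number of positions in which two lists differ. -/
def listDiff {γ : Type*} (L L' : List γ) : ℝ≥0∞ :=
  ∑' i : ℕ, if L[i]? = L'[i]? then 0 else 1

variable {γ γ' : Type*}

@[simp]
theorem listDiff_self (L : List γ) : listDiff L L = 0 := by simp [listDiff]

theorem listDiff_comm (L L' : List γ) : listDiff L L' = listDiff L' L := by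
  classical
  rw [listDiff, listDiff]
  refine tsum_congr fun i => ?_
  split_ifs <;> simp_all

theorem listDiff_triangle (L L' L'' : List γ) :
    listDiff L L'' ≤ listDiff L L' + listDiff L' L'' := by
  classical
  rw [listDiff, listDiff, listDiff, ← ENNReal.tsum_add]
  refine ENNReal.tsum_le_tsum fun i => ?_
  by_cases h : L[i]? = L'[i]?
  · simp [h]
  · simp only [h, if_false]
    split_ifs <;> simp

theorem listDiff_cons (a b : γ) (L L' : List γ) :
    listDiff (a :: L) (b :: L') = (open Classical in if a = b then 0 else 1) + listDiff L L' := by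
  classical
  rw [listDiff, tsum_eq_zero_add' ENNReal.summable]
  simp [listDiff]

theorem listDiff_cons_self (a : γ) (L L' : List γ) :
    listDiff (a :: L) (a :: L') = listDiff L L' := by
  simp [listDiff_cons]

theorem listDiff_cons_le (a b : γ) (L L' : List γ) :
    listDiff (a :: L) (b :: L') ≤ 1 + listDiff L L' := by
  rw [listDiff_cons]
  gcongr
  split_ifs <;> simp

theorem listDiff_nil_cons (b : γ) (L' : List γ) :
    listDiff [] (b :: L') = 1 + listDiff [] L' := by
  rw [listDiff, tsum_eq_zero_add' ENNReal.summable]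
  simp [listDiff]

theorem listDiff_nil_left (L : List γ) : listDiff [] L = L.length := by
  induction L with
  | nil => simp
  | cons a L ih => rw [listDiff_nil_cons, ih]; push_cast [List.length_cons]; ring

theorem listDiff_le_length (L L' : List γ) : listDiff L L' ≤ L.length + L'.length := by
  refine (listDiff_triangle L [] L').trans ?_
  rw [listDiff_comm L, listDiff_nil_left, listDiff_nil_left]

theorem listDiff_append {L₁ L₁' : List γ} (h : L₁.length = L₁'.length) (L L' : List γ) :
    listDiff (L₁ ++ L) (L₁' ++ L') = listDiff L₁ L₁' + listDiff L L' := by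
  induction L₁ generalizing L₁' with
  | nil =>
    obtain rfl : L₁' = [] := List.length_eq_zero_iff.1 h.symm
    simp
  | cons a L₁ ih =>
    cases L₁' with
    | nil => simp at h
    | cons b L₁' =>
      simp only [List.cons_append, listDiff_cons]
      rw [ih (by simpa using h), add_assoc]

theorem numDifferent_eq_listDiff {Ω : Type*} {k n : ℕ} {W : WeightModel Ω k}
    (G G' : List (CheckNode W n)) :
    (numDifferent G G' : ℝ≥0∞) = listDiff (G.map Prod.fst) (G'.map Prod.fst) := by
  classical
  rw [numDifferent, listDiff, tsum_eq_sum (s := Finset.range (max G.length G'.length))]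
  · rw [Finset.card_filter]
    push_cast
    refine Finset.sum_congr rfl fun i _ => ?_
    simp only [List.getElem?_map]
    split_ifs <;> simp_all
  · intro i hi
    simp only [Finset.mem_range, not_lt, sup_le_iff] at hi
    simp [List.getElem?_eq_none hi.1, List.getElem?_eq_none hi.2]

end ListDiff

/-! ### Drawing sockets -/

section Draws

variable {n : ℕ}

/-- Remove one socket of `x`. -/
def decr (δ : Fin n → ℕ) (x : Fin n) : Fin n → ℕ := fun y => δ y - if y = x then 1 else 0

/-- The residual degrees after the draws `L`. -/
def residual (δ : Fin n → ℕ) (L : List (Fin n)) : Fin n → ℕ := fun x => δ x - L.count x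

@[simp]
theorem residual_nil (δ : Fin n → ℕ) : residual δ [] = δ := by
  funext x
  simp [residual]

theorem residual_cons (δ : Fin n → ℕ) (x : Fin n) (L : List (Fin n)) :
    residual δ (x :: L) = residual (decr δ x) L := by
  funext y
  simp only [residual, decr, List.count_cons, beq_iff_eq, eq_comm (a := x)]
  omega

theorem residual_append (δ : Fin n → ℕ) (L L' : List (Fin n)) :
    residual δ (L ++ L') = residual (residual δ L) L' := by
  funext y
  simp only [residual, List.count_append]
  omega

theorem sum_decr_add_one {δ : Fin n → ℕ} {x : Fin n} (hx : δ x ≠ 0) :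
    ∑ y, decr δ x y + 1 = ∑ y, δ y := by
  have : (1 : ℕ) = ∑ y : Fin n, if y = x then 1 else 0 := by simp
  conv_lhs => rw [this]
  rw [← Finset.sum_add_distrib]
  refine Finset.sum_congr rfl fun y _ => ?_
  by_cases h : y = x
  · subst h
    simp only [decr, if_true]
    omega
  · simp [decr, h]

theorem le_sum_decr_add_one (δ : Fin n → ℕ) (x : Fin n) :
    ∑ y, δ y ≤ ∑ y, decr δ x y + 1 := by
  by_cases hx : δ x = 0
  · have : decr δ x = δ := by
      funext y
      by_cases h : y = x
      · subst h
        simp [decr, hx]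
      · simp [decr, h]
    rw [this]
    omega
  · exact (sum_decr_add_one hx).ge

/-- Only an inequality: draws with replacement may hit an exhausted node, and truncation then leaves
more sockets than the number of draws suggests. -/
theorem le_sum_residual_add (δ : Fin n → ℕ) (L : List (Fin n)) :
    ∑ y, δ y ≤ ∑ y, residual δ L y + L.length := by
  induction L generalizing δ with
  | nil => simp
  | cons x L ih =>
    have h1 := ih (decr δ x)
    have h2 := le_sum_decr_add_one δ x
    rw [residual_cons, List.length_cons]
    omega

variable [NeZero n]

theorem socketLaw_apply {δ : Fin n → ℕ} (h : ∑ x, δ x ≠ 0) (x : Fin n) :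
    socketLaw δ x = δ x * ((∑ y, δ y : ℕ) : ℝ≥0∞)⁻¹ := by
  rw [socketLaw, dif_neg h, PMF.normalize_apply, tsum_fintype]
  push_cast
  rfl

/-- The product form survives the uniform convention: with no sockets left both sides vanish. So in
mixtures the conventional law carries weight zero. -/
theorem sum_mul_socketLaw (δ : Fin n → ℕ) (x : Fin n) :
    ((∑ y, δ y : ℕ) : ℝ≥0∞) * socketLaw δ x = δ x := by
  by_cases h : ∑ y, δ y = 0
  · rw [h]
    rw [Finset.sum_eq_zero_iff] at h
    simp [h x (Finset.mem_univ _)]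
  · rw [socketLaw_apply h, mul_left_comm, ENNReal.mul_inv_cancel (by exact_mod_cast h)
      (ENNReal.natCast_ne_top _), mul_one]

theorem ne_zero_of_mem_support_socketLaw {δ : Fin n → ℕ} (h : ∑ x, δ x ≠ 0) {x : Fin n}
    (hx : x ∈ (socketLaw δ).support) : δ x ≠ 0 := by
  intro h0
  rw [PMF.mem_support_iff, socketLaw_apply h, h0] at hx
  simp at hx

/-- For distinct nodes of positive degree both sides are δ(x)δ(y)/(S(S-1)). Two sockets are required
so that the second draw never falls under the uniform convention. -/
theorem socketLaw_mul_swap {δ : Fin n → ℕ} (h : 2 ≤ ∑ x, δ x) (x y : Fin n) :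
    socketLaw δ x * socketLaw (decr δ x) y = socketLaw δ y * socketLaw (decr δ y) x := by
  have h0 : ∑ x, δ x ≠ 0 := by omega
  have hd : ∀ z, ∑ y, decr δ z y ≠ 0 := fun z => by
    have := le_sum_decr_add_one δ z
    omega
  rw [socketLaw_apply h0, socketLaw_apply h0, socketLaw_apply (hd x), socketLaw_apply (hd y)]
  by_cases hxy : x = y
  · rw [hxy]
  have e1 : decr δ x y = δ y := by simp [decr, Ne.symm hxy]
  have e2 : decr δ y x = δ x := by simp [decr, hxy]
  rw [e1, e2]
  by_cases hx : δ x = 0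
  · simp [hx]
  by_cases hy : δ y = 0
  · simp [hy]
  have e3 : ∑ z, decr δ x z = ∑ z, decr δ y z := by
    have h1 := sum_decr_add_one hx
    have h2 := sum_decr_add_one hy
    omega
  rw [e3]
  ring

theorem socketLaw_bind_swap {γ : Type*} {δ : Fin n → ℕ} (h : 2 ≤ ∑ x, δ x)
    (K : Fin n → Fin n → PMF γ) :
    ((socketLaw δ).bind fun x => (socketLaw (decr δ x)).bind fun y => K x y) =
      (socketLaw δ).bind fun y => (socketLaw (decr δ y)).bind fun x => K x y := by
  ext z
  simp only [PMF.bind_apply, ← ENNReal.tsum_mul_left]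
  rw [ENNReal.tsum_comm]
  refine tsum_congr fun y => tsum_congr fun x => ?_
  rw [← mul_assoc, ← mul_assoc, socketLaw_mul_swap h]

/-- The socket law of a sum of degree sequences is a mixture. -/
theorem exists_socketLaw_add (δ η : Fin n → ℕ) (h : ∑ x, δ x ≠ 0) :
    ∃ B : PMF Bool,
      B true = ((∑ x, η x : ℕ) : ℝ≥0∞) * ((∑ x, (δ + η) x : ℕ) : ℝ≥0∞)⁻¹ ∧
      socketLaw (δ + η) = B.bind fun b => bif b then socketLaw η else socketLaw δ := by
  have hs : ∑ x, (δ + η) x = ∑ x, η x + ∑ x, δ x := by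
    rw [add_comm δ η]
    simp [Finset.sum_add_distrib]
  have ht : (∑' b, bif b then ((∑ x, η x : ℕ) : ℝ≥0∞) else ((∑ x, δ x : ℕ) : ℝ≥0∞))
      = ((∑ x, (δ + η) x : ℕ) : ℝ≥0∞) := by
    rw [tsum_fintype, hs]
    simp
  have h0 : ∑ x, (δ + η) x ≠ 0 := by omega
  refine ⟨PMF.normalize (fun b => bif b then ((∑ x, η x : ℕ) : ℝ≥0∞) else ((∑ x, δ x : ℕ) : ℝ≥0∞))
    (by rw [ht]; exact_mod_cast h0) (by rw [ht]; exact ENNReal.natCast_ne_top _), ?_, ?_⟩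
  · rw [PMF.normalize_apply, ht]
    rfl
  · ext x
    rw [PMF.bind_apply, tsum_bool, PMF.normalize_apply, PMF.normalize_apply, ht,
      socketLaw_apply h0]
    simp only [cond_true, cond_false]
    rw [mul_right_comm, sum_mul_socketLaw, mul_right_comm, sum_mul_socketLaw, ← add_mul]
    simp

theorem socketLaw_single (x : Fin n) : socketLaw (Pi.single x 1) = PMF.pure x := by
  have h : ∑ y, (Pi.single x 1 : Fin n → ℕ) y = 1 := by simp
  ext y
  rw [socketLaw_apply (by rw [h]; simp), h, PMF.pure_apply]
  by_cases hy : y = x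
  · subst hy
    simp
  · simp [hy]

/-- `j` sockets drawn one after the other without replacement. -/
def drawList : (j : ℕ) → (Fin n → ℕ) → PMF (List (Fin n))
  | 0, _ => PMF.pure []
  | j + 1, δ => (socketLaw δ).bind fun x => (drawList j (decr δ x)).map (x :: ·)

theorem drawList_add (i j : ℕ) (δ : Fin n → ℕ) :
    drawList (i + j) δ =
      (drawList i δ).bind fun L => (drawList j (residual δ L)).map (L ++ ·) := by
  induction i generalizing δ with
  | zero =>
    simp only [Nat.zero_add, drawList, PMF.pure_bind, residual_nil, List.nil_append]
    exact (PMF.map_id _).symm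
  | succ i ih =>
    rw [Nat.succ_add, Nat.succ_eq_add_one, drawList, drawList, PMF.bind_bind]
    refine congrArg _ (funext fun x => ?_)
    rw [ih, PMF.map_bind, PMF.bind_map]
    simp [Function.comp_def, PMF.map_comp, residual_cons]

/-- Exchangeability: the first draw can be made last. -/
theorem drawList_succ_eq {j : ℕ} {δ : Fin n → ℕ} (h : j + 1 ≤ ∑ x, δ x) :
    drawList (j + 1) δ = (drawList j δ).bind fun L =>
      (socketLaw (residual δ L)).map (· :: L) := by
  induction j generalizing δ with
  | zero => simp [drawList, ← PMF.bind_pure_comp, Function.comp_def]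
  | succ j ih =>
    have hd : ∀ z, j + 1 ≤ ∑ y, decr δ z y := fun z => by
      have := le_sum_decr_add_one δ z
      omega
    have e1 : drawList (j + 1 + 1) δ = (socketLaw δ).bind fun x =>
        (socketLaw (decr δ x)).bind fun y =>
          (drawList j (decr (decr δ x) y)).map fun L => x :: y :: L := by
      rw [drawList]
      refine congrArg _ (funext fun x => ?_)
      rw [drawList, PMF.map_bind]
      simp [PMF.map_comp, Function.comp_def]
    have e2 : ∀ x y, decr (decr δ x) y = decr (decr δ y) x := fun x y => by
      funext z
      simp only [decr]
      omega
    rw [e1, socketLaw_bind_swap (by omega)]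
    conv_rhs => rw [drawList, PMF.bind_bind]
    refine congrArg _ (funext fun y => ?_)
    -- The induction hypothesis for the draws after `y`, with `y` reinserted behind the first entry;
    -- the empty list does not occur.
    have e3 := congrArg (fun μ : PMF (List (Fin n)) => μ.bind fun L =>
      match L with
      | [] => PMF.pure []
      | x :: L => PMF.pure (x :: y :: L)) (ih (hd y))
    simp only [drawList, PMF.bind_bind, PMF.bind_map, Function.comp_def] at e3
    simp only [e2 _ y, ← PMF.bind_pure_comp, PMF.bind_bind, Function.comp_def, PMF.pure_bind,
      residual_cons] at e3 ⊢
    exact e3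

/-- An additional socket changes at most one draw in expectation. -/
theorem coupled_drawList_add_single {j : ℕ} {δ : Fin n → ℕ} (h : j ≤ ∑ x, δ x) (x : Fin n) :
    Coupled listDiff (drawList j δ) (drawList j (δ + Pi.single x 1)) 1 := by
  induction j generalizing δ with
  | zero => exact coupled_pure (by simp)
  | succ j ih =>
    have h0 : ∑ y, δ y ≠ 0 := by omega
    obtain ⟨B, -, hB⟩ := exists_socketLaw_add δ (Pi.single x 1) h0
    -- The coin `B` decides whether the first draw is the additional socket; if it is, exactly `δ`
    -- is left.
    have e : drawList (j + 1) (δ + Pi.single x 1) = B.bind fun b =>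
        bif b then (drawList j δ).map (x :: ·)
        else (socketLaw δ).bind fun y => (drawList j (decr (δ + Pi.single x 1) y)).map (y :: ·) := by
      rw [drawList, hB, PMF.bind_bind]
      refine congrArg _ (funext fun b => ?_)
      cases b with
      | false => rfl
      | true =>
        have : decr (δ + Pi.single x 1) x = δ := by
          funext y
          by_cases hy : y = x
          · subst hy
            simp [decr]
          · simp [decr, hy]
        simp [socketLaw_single, this]
    -- The other side is written as a trivial mixture over the same coin, so that both can be
    -- conditioned on it.
    rw [e, ← PMF.bind_const B (drawList (j + 1) δ)]
    refine Coupled.bind_same_const fun b _ => ?_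
    cases b with
    | true =>
      -- Making the first draw from `δ` last gives both lists the same tail `L`, so only their first
      -- entries differ.
      rw [drawList_succ_eq h, cond_true, ← PMF.bind_pure_comp]
      refine Coupled.bind_same_const fun L _ => ?_
      rw [← PMF.bind_pure_comp, Function.comp_apply, ← PMF.bind_const (socketLaw (residual δ L))
        (PMF.pure (x :: L))]
      refine Coupled.bind_same_const fun y _ => coupled_pure ?_
      exact (listDiff_cons_le _ _ _ _).trans (by simp)
    | false =>
      rw [cond_false, drawList]
      refine Coupled.bind_same_const fun y hy => Coupled.map ?_
      have hy' := ne_zero_of_mem_support_socketLaw h0 hy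
      have e' : decr (δ + Pi.single x 1) y = decr δ y + Pi.single x 1 := by
        funext z
        by_cases hz : z = y
        · subst hz
          simp only [decr, Pi.add_apply, if_true]
          omega
        · simp [decr, hz]
      rw [e']
      simp only [listDiff_cons_self]
      refine ih ?_
      have := le_sum_decr_add_one δ y
      omega

theorem coupled_drawList_add {j : ℕ} {δ : Fin n → ℕ} (h : j ≤ ∑ x, δ x) (η : Fin n → ℕ) :
    Coupled listDiff (drawList j δ) (drawList j (δ + η)) ((∑ x, η x : ℕ) : ℝ≥0∞) := by
  generalize hs : ∑ x, η x = s
  induction s generalizing η with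
  | zero =>
    have : η = 0 := by
      funext x
      exact Finset.sum_eq_zero_iff.1 hs x (Finset.mem_univ _)
    rw [this, add_zero]
    exact coupled_refl _ (by simp)
  | succ s ih =>
    obtain ⟨x, -, hx⟩ : ∃ x ∈ Finset.univ, η x ≠ 0 := by
      by_contra! hc
      rw [Finset.sum_eq_zero hc] at hs
      omega
    have e : η = decr η x + Pi.single x 1 := by
      funext y
      by_cases hy : y = x
      · subst hy
        simp only [decr, Pi.add_apply, if_true, Pi.single_eq_same]
        omega
      · simp [decr, hy]
    have h1 := ih (decr η x) (by have := sum_decr_add_one hx; omega)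
    have h2 : j ≤ ∑ y, (δ + decr η x) y := h.trans (by simp [Finset.sum_add_distrib])
    have h3 := coupled_drawList_add_single h2 x
    rw [add_assoc, ← e] at h3
    push_cast
    exact h1.trans h3 listDiff_triangle

/-- Draws without replacement from two degree sequences. -/
theorem coupled_drawList {j : ℕ} {δ δ' : Fin n → ℕ} (h : j ≤ ∑ x, δ x) (h' : j ≤ ∑ x, δ' x) :
    Coupled listDiff (drawList j δ) (drawList j δ')
      ((∑ x, ((δ' x - δ x) + (δ x - δ' x)) : ℕ) : ℝ≥0∞) := by
  have h1 := coupled_drawList_add h (fun x => δ' x - δ x)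
  have h2 := (coupled_drawList_add h' (fun x => δ x - δ' x)).symm
  -- Both sides are the pointwise maximum, which serves as the intermediate degree sequence.
  have e : δ' + (fun x => δ x - δ' x) = δ + fun x => δ' x - δ x := by
    funext x
    simp only [Pi.add_apply]
    omega
  rw [e] at h2
  rw [Finset.sum_add_distrib, Nat.cast_add]
  exact h1.trans h2 fun L₁ L₂ L₃ => by
    rw [listDiff_comm L₃]
    exact listDiff_triangle _ _ _

/-! ### Draws with replacement -/

/-- `j` independent samples, as a list. -/
def iidList {γ : Type*} (μ : PMF γ) : (j : ℕ) → PMF (List γ)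
  | 0 => PMF.pure []
  | j + 1 => μ.bind fun x => (iidList μ j).map (x :: ·)

theorem length_of_mem_support_iidList {γ : Type*} {μ : PMF γ} {j : ℕ} {L : List γ}
    (h : L ∈ (iidList μ j).support) : L.length = j := by
  induction j generalizing L with
  | zero =>
    rw [iidList, PMF.mem_support_pure_iff] at h
    simp [h]
  | succ j ih =>
    rw [iidList, PMF.mem_support_bind_iff] at h
    obtain ⟨x, _, h⟩ := h
    rw [PMF.mem_support_map_iff] at h
    obtain ⟨L', h, rfl⟩ := h
    simp [ih h]

theorem iidList_add {γ : Type*} (μ : PMF γ) (i j : ℕ) :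
    iidList μ (i + j) = (iidList μ i).bind fun L => (iidList μ j).map (L ++ ·) := by
  induction i with
  | zero =>
    simp only [Nat.zero_add, iidList, PMF.pure_bind, List.nil_append]
    exact (PMF.map_id _).symm
  | succ i ih =>
    rw [Nat.succ_add, Nat.succ_eq_add_one, iidList, iidList, PMF.bind_bind]
    refine congrArg _ (funext fun x => ?_)
    rw [ih, PMF.map_bind, PMF.bind_map]
    simp [Function.comp_def, PMF.map_comp]

theorem iid_map_ofFn {γ : Type*} (μ : PMF γ) (j : ℕ) :
    (iid μ j).map List.ofFn = iidList μ j := by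
  induction j with
  | zero => simp [iid, iidList, PMF.pure_map]
  | succ j ih =>
    rw [iid, iidList, PMF.map_bind]
    refine congrArg _ (funext fun x => ?_)
    rw [← ih, PMF.map_bind, PMF.map_comp, ← PMF.bind_pure_comp]
    simp [PMF.pure_map, Function.comp_def]

/-- Draws without and with replacement. -/
theorem coupled_drawList_iidList {j : ℕ} {δ η : Fin n → ℕ} (h : j ≤ ∑ x, δ x) :
    Coupled listDiff (drawList j δ) (iidList (socketLaw (δ + η)) j)
      (j * (∑ x, η x + j : ℕ) * ((∑ x, (δ + η) x : ℕ) : ℝ≥0∞)⁻¹) := by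
  induction j generalizing δ η with
  | zero => exact coupled_pure (by simp)
  | succ j ih =>
    have h0 : ∑ y, δ y ≠ 0 := by omega
    have hrest : ∀ y ∈ (socketLaw δ).support, Coupled listDiff (drawList j (decr δ y))
        (iidList (socketLaw (δ + η)) j)
        (j * (∑ x, η x + (j + 1) : ℕ) * ((∑ x, (δ + η) x : ℕ) : ℝ≥0∞)⁻¹) := by
      intro y hy
      have hy' := ne_zero_of_mem_support_socketLaw h0 hy
      -- `η` records the sockets already used up. Moving the drawn socket from `δ` to `η` keeps the
      -- law of the draws with replacement fixed.
      have e : δ + η = decr δ y + (η + Pi.single y 1) := by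
        funext z
        by_cases hz : z = y
        · subst hz
          simp only [decr, Pi.add_apply, if_true, Pi.single_eq_same]
          omega
        · simp [decr, hz]
      have := ih (δ := decr δ y) (η := η + Pi.single y 1)
        (by have := le_sum_decr_add_one δ y; omega)
      rw [← e] at this
      convert this using 4
      simp [Finset.sum_add_distrib]
      ring
    obtain ⟨B, hB1, hB⟩ := exists_socketLaw_add δ η h0
    have e : iidList (socketLaw (δ + η)) (j + 1) = B.bind fun b =>
        (bif b then socketLaw η else socketLaw δ).bind fun x =>
          (iidList (socketLaw (δ + η)) j).map (x :: ·) := by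
      exact (congrArg (fun μ : PMF (Fin n) => μ.bind fun x =>
        (iidList (socketLaw (δ + η)) j).map (x :: ·)) hB).trans (PMF.bind_bind _ _ _)
    rw [e, ← PMF.bind_const B (drawList (j + 1) δ)]
    -- A difference arises when the draw with replacement hits a used socket, which has probability
    -- Ση/Σ(δ+η).
    refine Coupled.bind_same (g := fun b => (bif b then 1 else 0) +
      (j * (∑ x, η x + (j + 1) : ℕ) * ((∑ x, (δ + η) x : ℕ) : ℝ≥0∞)⁻¹)) ?_ fun b _ => ?_
    · rw [expect_add, expect_const, expect, tsum_bool]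
      simp only [cond_true, cond_false, mul_zero, mul_one, zero_add]
      rw [hB1, ← add_mul]
      gcongr
      rw [← Nat.cast_mul, ← Nat.cast_add, ← Nat.cast_mul, Nat.cast_le]
      nlinarith
    · rw [drawList]
      cases b with
      | false =>
        refine Coupled.bind_same_const fun y hy => Coupled.map ?_
        simp only [listDiff_cons_self, cond_false, zero_add]
        exact hrest y hy
      | true =>
        simp only [cond_true]
        have : Coupled (fun _ _ => (1 + (j * (∑ x, η x + (j + 1) : ℕ) *
          ((∑ x, (δ + η) x : ℕ) : ℝ≥0∞)⁻¹) : ℝ≥0∞)) (socketLaw δ) (socketLaw η)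
          (1 + (j * (∑ x, η x + (j + 1) : ℕ) * ((∑ x, (δ + η) x : ℕ) : ℝ≥0∞)⁻¹)) :=
          coupled_of_forall _ _ fun _ _ _ _ => le_rfl
        refine this.bind fun y hy z _ => Coupled.map ?_
        obtain ⟨π, h1, h2, h3⟩ := hrest y hy
        refine ⟨π, h1, h2, ?_⟩
        calc expect π (fun p => listDiff (y :: p.1) (z :: p.2))
            ≤ expect π (fun p => 1 + listDiff p.1 p.2) := expect_mono fun p => listDiff_cons_le _ _ _ _
          _ ≤ _ := by
            rw [expect_add, expect_const]
            gcongr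

end Draws

/-! ### Comparison of the layered graph and the configuration model -/

section Lists

variable {γ : Type*}

theorem one_le_listDiff {L L' : List γ} (h : L ≠ L') : 1 ≤ listDiff L L' := by
  classical
  obtain ⟨i, hi⟩ : ∃ i : ℕ, L[i]? ≠ L'[i]? := by
    by_contra! hc
    exact h (List.ext_getElem? hc)
  refine le_trans ?_ (ENNReal.le_tsum i)
  simp [hi]

variable {n k : ℕ}

/-- All neighbours of a list of check nodes, in the order of creation. -/
def neighbours (F : List (Fin k → Fin n)) : List (Fin n) := F.flatMap List.ofFn

@[simp]
theorem neighbours_nil : neighbours ([] : List (Fin k → Fin n)) = [] := rfl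

@[simp]
theorem neighbours_cons (a : Fin k → Fin n) (F : List (Fin k → Fin n)) :
    neighbours (a :: F) = List.ofFn a ++ neighbours F := rfl

theorem length_neighbours (F : List (Fin k → Fin n)) :
    (neighbours F).length = F.length * k := by
  induction F with
  | nil => simp
  | cons a F ih => simp [ih]; ring

/-- Each differing check node contains at least one differing neighbour. -/
theorem listDiff_le_listDiff_neighbours {F F' : List (Fin k → Fin n)}
    (h : F.length = F'.length) : listDiff F F' ≤ listDiff (neighbours F) (neighbours F') := by
  induction F generalizing F' with
  | nil =>
    obtain rfl : F' = [] := List.length_eq_zero_iff.1 h.symm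
    simp
  | cons a F ih =>
    cases F' with
    | nil => simp at h
    | cons b F' =>
      rw [listDiff_cons, neighbours_cons, neighbours_cons, listDiff_append (by simp)]
      refine add_le_add ?_ (ih (by simpa using h))
      split_ifs with hab
      · simp
      · exact one_le_listDiff fun hc => hab (List.ofFn_injective hc)

/-- Replacing one entry changes two counts by one each, hence the factor 2. -/
theorem sum_count_diff_le {L L' : List (Fin n)} (h : L.length = L'.length) :
    ((∑ x, ((L'.count x - L.count x) + (L.count x - L'.count x)) : ℕ) : ℝ≥0∞)
      ≤ 2 * listDiff L L' := by
  induction L generalizing L' with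
  | nil =>
    obtain rfl : L' = [] := List.length_eq_zero_iff.1 h.symm
    simp
  | cons a L ih =>
    cases L' with
    | nil => simp at h
    | cons b L' =>
      have ih' := ih (L' := L') (by simpa using h)
      rw [listDiff_cons]
      by_cases hab : a = b
      · subst hab
        rw [if_pos rfl, zero_add]
        simpa only [List.count_cons, Nat.add_sub_add_right] using ih'
      · have h1 : ∑ x, (((b :: L').count x - (a :: L).count x) +
            ((a :: L).count x - (b :: L').count x)) ≤
            2 + ∑ x, ((L'.count x - L.count x) + (L.count x - L'.count x)) := by
          have h2 : (2 : ℕ) = ∑ x : Fin n, ((if x = a then 1 else 0) + if x = b then 1 else 0) := by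
            simp [Finset.sum_add_distrib]
          rw [h2, ← Finset.sum_add_distrib]
          refine Finset.sum_le_sum fun x _ => ?_
          simp only [List.count_cons, beq_iff_eq, eq_comm (b := x)]
          split_ifs <;> omega
        rw [if_neg hab, mul_add, mul_one]
        refine le_trans (Nat.cast_le.2 h1) ?_
        rw [Nat.cast_add]
        exact add_le_add le_rfl ih'

/-- Truncated subtraction from a fixed number is 1-Lipschitz, so the bound on the counts carries
over. -/
theorem sum_residual_diff_le (δ : Fin n → ℕ) {L L' : List (Fin n)} (h : L.length = L'.length) :
    ((∑ x, ((residual δ L' x - residual δ L x) + (residual δ L x - residual δ L' x)) : ℕ) : ℝ≥0∞)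
      ≤ 2 * listDiff L L' := by
  refine le_trans (Nat.cast_le.2 (Finset.sum_le_sum fun x _ => ?_)) (sum_count_diff_le h)
  simp only [residual]
  omega

theorem multiplicity_eq_count {m : ℕ} (a : Fin m → Fin k → Fin n) (x : Fin n) :
    multiplicity a x = (neighbours (List.ofFn a)).count x := by
  have h1 : ∀ k (b : Fin k → Fin n), (List.ofFn b).count x = ∑ j, if b j = x then 1 else 0 := by
    intro k
    induction k with
    | zero => simp
    | succ k ih =>
      intro b
      rw [List.ofFn_succ, List.count_cons, ih, Fin.sum_univ_succ, add_comm]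
      simp
  have h2 : ∀ m (a : Fin m → Fin k → Fin n), (neighbours (List.ofFn a)).count x =
      ∑ i, ∑ j, if a i j = x then 1 else 0 := by
    intro m
    induction m with
    | zero => simp
    | succ m ih =>
      intro a
      rw [List.ofFn_succ, neighbours_cons, List.count_append, ih, Fin.sum_univ_succ, h1]
  rw [h2, multiplicity, Finset.card_filter, Fintype.sum_prod_type]

theorem iidList_map_neighbours (μ : PMF (Fin n)) (m : ℕ) :
    (iidList (iid μ k) m).map neighbours = iidList μ (m * k) := by
  induction m with
  | zero => simp [iidList, PMF.pure_map]
  | succ m ih =>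
    rw [iidList, Nat.succ_mul, add_comm, iidList_add, ← iid_map_ofFn μ k,
      PMF.map_bind, PMF.bind_map]
    refine congrArg _ (funext fun q => ?_)
    simp [← ih, PMF.map_comp, Function.comp_def]

end Lists

/-! ### The configuration model and the layered graph as sequences of draws -/

section Config

variable {n : ℕ} [NeZero n]

/-- The residual degrees are a function of the draws and need not be tracked separately. -/
theorem snd_of_mem_support_drawUpdating {j : ℕ} {δ : Fin n → ℕ}
    {q : (Fin j → Fin n) × (Fin n → ℕ)} (h : q ∈ (drawUpdating j δ).support) :
    q.2 = residual δ (List.ofFn q.1) := by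
  induction j generalizing δ with
  | zero =>
    rw [drawUpdating, PMF.mem_support_pure_iff] at h
    simp [h]
  | succ j ih =>
    simp only [drawUpdating, PMF.mem_support_bind_iff, PMF.mem_support_pure_iff] at h
    obtain ⟨x, _, q', hq', rfl⟩ := h
    rw [List.ofFn_cons, residual_cons]
    exact ih hq'

theorem drawUpdating_map_ofFn (j : ℕ) (δ : Fin n → ℕ) :
    (drawUpdating j δ).map (fun q => List.ofFn q.1) = drawList j δ := by
  induction j generalizing δ with
  | zero => simp [drawUpdating, drawList, PMF.pure_map]
  | succ j ih =>
    rw [drawUpdating, drawList, PMF.map_bind]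
    refine congrArg _ (funext fun x => ?_)
    rw [← ih, PMF.map_bind, PMF.map_comp, ← PMF.bind_pure_comp]
    refine congrArg _ (funext fun q => ?_)
    simp [PMF.pure_map]

variable {k : ℕ}

theorem length_of_mem_support_configChecks {r : ℕ} {δ : Fin n → ℕ} {F : List (Fin k → Fin n)}
    (h : F ∈ (configChecks k r δ).support) : F.length = r := by
  induction r generalizing δ F with
  | zero =>
    rw [configChecks, PMF.mem_support_pure_iff] at h
    simp [h]
  | succ r ih =>
    simp only [configChecks, PMF.mem_support_bind_iff, PMF.mem_support_pure_iff] at h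
    obtain ⟨q, _, F', hF', rfl⟩ := h
    simp [ih hF']

theorem configChecks_succ (r : ℕ) (δ : Fin n → ℕ) :
    configChecks k (r + 1) δ = (drawUpdating k δ).bind fun q =>
      (configChecks k r (residual δ (List.ofFn q.1))).map (q.1 :: ·) := by
  rw [configChecks]
  refine bind_congr_support fun q hq => ?_
  rw [snd_of_mem_support_drawUpdating hq, ← PMF.bind_pure_comp]
  rfl

theorem configChecks_map_neighbours (r : ℕ) (δ : Fin n → ℕ) :
    (configChecks k r δ).map neighbours = drawList (r * k) δ := by
  induction r generalizing δ with
  | zero => simp [configChecks, drawList, PMF.pure_map]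
  | succ r ih =>
    rw [configChecks_succ, Nat.succ_mul, add_comm, drawList_add, ← drawUpdating_map_ofFn,
      PMF.map_bind, PMF.bind_map]
    refine congrArg _ (funext fun q => ?_)
    simp [← ih, PMF.map_comp, Function.comp_def]

theorem configChecks_add (i r : ℕ) (δ : Fin n → ℕ) :
    configChecks k (i + r) δ = (configChecks k i δ).bind fun F =>
      (configChecks k r (residual δ (neighbours F))).map (F ++ ·) := by
  induction i generalizing δ with
  | zero =>
    simp only [Nat.zero_add, configChecks, PMF.pure_bind, neighbours_nil, residual_nil,
      List.nil_append]
    exact (PMF.map_id _).symm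
  | succ i ih =>
    rw [Nat.succ_add, Nat.succ_eq_add_one, configChecks_succ, configChecks_succ, PMF.bind_bind]
    refine congrArg _ (funext fun q => ?_)
    rw [ih, PMF.map_bind, PMF.bind_map]
    simp [Function.comp_def, PMF.map_comp, residual_append]

/-- Stability of the configuration model: the coupling of the draws lifts to check nodes along
`neighbours`. -/
theorem coupled_configChecks {r : ℕ} {δ δ' : Fin n → ℕ} (h : r * k ≤ ∑ x, δ x)
    (h' : r * k ≤ ∑ x, δ' x) :
    Coupled listDiff (configChecks k r δ) (configChecks k r δ')
      ((∑ x, ((δ' x - δ x) + (δ x - δ' x)) : ℕ) : ℝ≥0∞) := by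
  have := coupled_drawList h h'
  rw [← configChecks_map_neighbours, ← configChecks_map_neighbours] at this
  refine this.of_map.mono_cost fun F hF F' hF' => listDiff_le_listDiff_neighbours ?_
  rw [length_of_mem_support_configChecks hF, length_of_mem_support_configChecks hF']

theorem layeredGraph_cons (m : ℕ) (ms : List ℕ) (δ : Fin n → ℕ) :
    layeredGraph k (m :: ms) δ = (iidList (iid (socketLaw δ) k) m).bind fun F =>
      (layeredGraph k ms (residual δ (neighbours F))).map fun q => (F ++ q.1, q.2) := by
  rw [layeredGraph, ← iid_map_ofFn, PMF.bind_map]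
  refine congrArg _ (funext fun a => ?_)
  simp only [multiplicity_eq_count, Function.comp_apply, ← PMF.bind_pure_comp]
  rfl

theorem length_of_mem_support_layeredGraph {ms : List ℕ} {δ : Fin n → ℕ}
    {q : List (Fin k → Fin n) × (Fin n → ℕ)} (h : q ∈ (layeredGraph k ms δ).support) :
    q.1.length = ms.sum := by
  induction ms generalizing δ q with
  | nil =>
    rw [layeredGraph, PMF.mem_support_pure_iff] at h
    simp [h]
  | cons m ms ih =>
    simp only [layeredGraph, PMF.mem_support_bind_iff, PMF.mem_support_pure_iff] at h
    obtain ⟨a, _, q', hq', rfl⟩ := h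
    simp [ih hq']

/-- The layered graph with layer sizes `ms`, and additional check nodes of the configuration model
until there are `r` check nodes. -/
def completedGraph (k : ℕ) (ms : List ℕ) (r : ℕ) (δ : Fin n → ℕ) :
    PMF (List (Fin k → Fin n) × List (Fin k → Fin n)) :=
  (layeredGraph k ms δ).bind fun q =>
    (configChecks k (r - q.1.length) q.2).map fun A => (q.1, A)

theorem completedGraph_cons (m : ℕ) (ms : List ℕ) (r : ℕ) (δ : Fin n → ℕ) :
    completedGraph k (m :: ms) r δ = (iidList (iid (socketLaw δ) k) m).bind fun F =>
      (completedGraph k ms (r - m) (residual δ (neighbours F))).map fun q => (F ++ q.1, q.2) := by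
  rw [completedGraph, layeredGraph_cons, PMF.bind_bind]
  refine bind_congr_support fun F hF => ?_
  rw [completedGraph, PMF.map_bind, PMF.bind_map]
  refine congrArg _ (funext fun q => ?_)
  simp [PMF.map_comp, Function.comp_def, length_of_mem_support_iidList hF, Nat.sub_sub]

/-- Replacing the first `m` check nodes by a layer with independent neighbours. -/
theorem coupled_layer {m r b : ℕ} {δ : Fin n → ℕ} (hm : m ≤ r) (hr : r * k ≤ ∑ x, δ x)
    (hb : b ≤ ∑ x, δ x) :
    Coupled listDiff
      ((iidList (iid (socketLaw δ) k) m).bind fun F =>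
        (configChecks k (r - m) (residual δ (neighbours F))).map (F ++ ·))
      (configChecks k r δ) (3 * ((m * k : ℕ) ^ 2 * (b : ℝ≥0∞)⁻¹)) := by
  obtain ⟨s, rfl⟩ := Nat.exists_eq_add_of_le hm
  rw [add_mul] at hr
  have h1 := (coupled_drawList_iidList (j := m * k) (δ := δ) (η := 0) (by omega)).symm
  rw [← configChecks_map_neighbours, ← iidList_map_neighbours, add_zero] at h1
  have h2 := h1.of_map
  obtain ⟨π, h3, h4, h5⟩ := h2
  -- Each differing draw is charged 3: one for its own check node and two for the residual degrees
  -- it alters in the remaining graph.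
  have h6 : Coupled (fun F F' => 3 * listDiff (neighbours F) (neighbours F'))
      (iidList (iid (socketLaw δ) k) m) (configChecks k m δ)
      (3 * ((m * k : ℕ) ^ 2 * (b : ℝ≥0∞)⁻¹)) := by
    refine ⟨π, h3, h4, ?_⟩
    rw [expect_const_mul]
    gcongr
    refine le_trans (by simpa only [listDiff_comm] using h5) ?_
    simp only [Pi.zero_apply, Finset.sum_const_zero, zero_add]
    rw [sq]
    gcongr
  rw [configChecks_add, Nat.add_sub_cancel_left]
  refine h6.bind fun F hF F' hF' => Coupled.map ?_
  have l1 := length_of_mem_support_iidList hF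
  have l2 := length_of_mem_support_configChecks hF'
  have l3 : (neighbours F).length = (neighbours F').length := by
    rw [length_neighbours, length_neighbours, l1, l2]
  have t1 := le_sum_residual_add δ (neighbours F)
  have t2 := le_sum_residual_add δ (neighbours F')
  rw [length_neighbours, l1] at t1
  rw [length_neighbours, l2] at t2
  have h7 := (coupled_configChecks (k := k) (r := s) (δ := residual δ (neighbours F))
    (δ' := residual δ (neighbours F')) (by omega) (by omega)).mono (sum_residual_diff_le δ l3)
  obtain ⟨ρ, h8, h9, h10⟩ := h7
  refine ⟨ρ, h8, h9, ?_⟩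
  simp only [listDiff_append (l1.trans l2.symm)]
  rw [expect_add, expect_const]
  calc _ ≤ listDiff (neighbours F) (neighbours F') + 2 * listDiff (neighbours F) (neighbours F') :=
        add_le_add (listDiff_le_listDiff_neighbours (l1.trans l2.symm)) h10
    _ = _ := by ring

/-- A hybrid argument: the later layers are replaced by induction, given the first, which is then
replaced by `coupled_layer`. The hypothesis on `b` guarantees at least `b` sockets at the start of
every layer. -/
theorem coupled_completedGraph {ms : List ℕ} {r b : ℕ} {δ : Fin n → ℕ} (hm : ms.sum ≤ r)
    (hr : r * k ≤ ∑ x, δ x) (hb : b + ms.sum * k ≤ ∑ x, δ x) :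
    Coupled (fun q F => listDiff (q.1 ++ q.2) F) (completedGraph k ms r δ) (configChecks k r δ)
      (ms.map fun m : ℕ => 3 * ((m * k : ℕ) ^ 2 * (b : ℝ≥0∞)⁻¹)).sum := by
  induction ms generalizing r δ with
  | nil =>
    rw [completedGraph, layeredGraph, PMF.pure_bind]
    have := Coupled.map (c := fun q F => listDiff (q.1 ++ q.2) F) (C := 0)
      (f := fun A : List (Fin k → Fin n) => (([] : List (Fin k → Fin n)), A)) (g := id)
      (coupled_refl (configChecks k r δ) (by simp))
    rw [PMF.map_id] at this
    simpa using this
  | cons m ms ih =>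
    rw [List.sum_cons] at hm hb
    rw [add_mul] at hb
    rw [List.map_cons, List.sum_cons, add_comm, completedGraph_cons]
    refine Coupled.trans (c' := listDiff) ?_ (coupled_layer (r := r) (by omega) hr (by omega))
      (fun x y z => listDiff_triangle (x.1 ++ x.2) y z)
    refine Coupled.bind_same_const fun F hF => Coupled.map ?_
    have l1 := length_of_mem_support_iidList hF
    have t1 := le_sum_residual_add δ (neighbours F)
    rw [length_neighbours, l1] at t1
    simp only [List.append_assoc, listDiff_append (rfl : F.length = F.length), listDiff_self,
      zero_add]
    refine ih (by omega) ?_ (by omega)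
    rw [Nat.sub_mul]
    omega

/-- Fallback for layer sizes that nearly use up the sockets: every check node of either graph is
counted as different. -/
theorem coupled_completedGraph_trivial (ms : List ℕ) (r : ℕ) (δ : Fin n → ℕ) :
    Coupled (fun q F => listDiff (q.1 ++ q.2) F) (completedGraph k ms r δ) (configChecks k r δ)
      (ms.sum + 2 * r : ℕ) := by
  refine coupled_of_forall _ _ fun q hq F hF => ?_
  simp only [completedGraph, PMF.mem_support_bind_iff, PMF.mem_support_map_iff] at hq
  obtain ⟨q', hq', A, hA, rfl⟩ := hq
  refine (listDiff_le_length _ _).trans ?_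
  rw [length_of_mem_support_configChecks hF, List.length_append,
    length_of_mem_support_configChecks hA, length_of_mem_support_layeredGraph hq', ← Nat.cast_add,
    Nat.cast_le]
  omega

end Config

/-! ### Sums of independent Poisson variables -/

section Poisson

theorem poisson_succ_mul (r : ℝ≥0) (j : ℕ) :
    poisson r (j + 1) * ((j + 1 : ℕ) : ℝ≥0∞) = r * poisson r j := by
  rw [poisson_apply, poisson_apply, ← ENNReal.ofReal_natCast, ← ENNReal.ofReal_mul (by positivity),
    ← ENNReal.ofReal_coe_nnreal, ← ENNReal.ofReal_mul (by positivity)]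
  congr 1
  rw [Nat.factorial_succ, pow_succ]
  have : (j.factorial : ℝ) ≠ 0 := by positivity
  push_cast
  field_simp

/-- The Chen–Stein identity, from which the first two moments follow. -/
theorem expect_poisson_mul (r : ℝ≥0) (g : ℕ → ℝ≥0∞) :
    expect (poisson r) (fun j => j * g j) = r * expect (poisson r) fun j => g (j + 1) := by
  rw [expect, tsum_eq_zero_add' ENNReal.summable, expect, ← ENNReal.tsum_mul_left]
  simp only [Nat.cast_zero, zero_mul, mul_zero, zero_add]
  refine tsum_congr fun j => ?_
  rw [← mul_assoc, poisson_succ_mul, mul_assoc]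

theorem expect_poisson_id (r : ℝ≥0) : expect (poisson r) (fun j => j) = r := by
  have := expect_poisson_mul r fun _ => 1
  simpa using this

theorem expect_poisson_sq (r : ℝ≥0) : expect (poisson r) (fun j => (j : ℝ≥0∞) ^ 2) = r + r ^ 2 := by
  have := expect_poisson_mul r fun j => j
  simp only [← sq, Nat.cast_add, Nat.cast_one] at this
  rw [this, expect_add, expect_poisson_id, expect_const]
  ring

theorem expect_iidList_sum_map {γ : Type*} (μ : PMF γ) (g : γ → ℝ≥0∞) (s : ℕ) :
    expect (iidList μ s) (fun L => (L.map g).sum) = s * expect μ g := by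
  induction s with
  | zero => simp [iidList]
  | succ s ih =>
    simp only [iidList, expect_bind, expect_map, List.map_cons, List.sum_cons, expect_add,
      expect_const, ih]
    push_cast
    ring

theorem expect_iidList_poisson_sum (r : ℝ≥0) (s : ℕ) :
    expect (iidList (poisson r) s) (fun L => (L.sum : ℝ≥0∞)) = s * r := by
  have := expect_iidList_sum_map (poisson r) (fun j => (j : ℝ≥0∞)) s
  rw [expect_poisson_id] at this
  simpa [Nat.cast_list_sum] using this

theorem expect_iidList_poisson_sum_sq (r : ℝ≥0) (s : ℕ) :
    expect (iidList (poisson r) s) (fun L => (L.sum : ℝ≥0∞) ^ 2) = s * r + (s * r) ^ 2 := by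
  induction s with
  | zero => simp [iidList]
  | succ s ih =>
    have e : ∀ x y : ℝ≥0∞, (x + y) ^ 2 = x ^ 2 + 2 * x * y + y ^ 2 := fun x y => by ring
    have e' : ∀ x y : ℝ≥0∞, 2 * x * y = (2 * y) * x := fun x y => by ring
    simp only [iidList, expect_bind, expect_map, List.sum_cons, Nat.cast_add, e, expect_add,
      expect_const, expect_const_mul, ih, expect_iidList_poisson_sum]
    simp only [e', expect_const_mul, expect_poisson_id, expect_poisson_sq]
    push_cast
    ring

theorem expect_iidList_poisson_variance (r : ℝ≥0) (s : ℕ) :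
    expect (iidList (poisson r) s) (fun L => ENNReal.ofReal (((L.sum : ℝ) - s * r) ^ 2))
      = s * r := by
  -- The square is expanded with the cross term on the other side, to avoid subtraction in `ℝ≥0∞`;
  -- its finite expectation is cancelled at the end.
  have key : ∀ N : ℕ, ENNReal.ofReal (((N : ℝ) - s * r) ^ 2) + (2 * (s * r)) * (N : ℝ≥0∞)
      = (N : ℝ≥0∞) ^ 2 + (s * r) ^ 2 := by
    intro N
    have e1 : (2 * (s * r)) * (N : ℝ≥0∞) = ENNReal.ofReal (2 * (s * r) * N) := by
      rw [ENNReal.ofReal_mul (by positivity), ENNReal.ofReal_mul (by positivity),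
        ENNReal.ofReal_mul (by positivity)]
      simp
    have e2 : (N : ℝ≥0∞) ^ 2 + (s * r) ^ 2 = ENNReal.ofReal ((N : ℝ) ^ 2 + (s * r) ^ 2) := by
      rw [ENNReal.ofReal_add (by positivity) (by positivity), ENNReal.ofReal_pow (by positivity),
        ENNReal.ofReal_pow (by positivity), ENNReal.ofReal_mul (by positivity)]
      simp
    rw [e1, e2, ← ENNReal.ofReal_add (by positivity) (by positivity)]
    congr 1
    ring
  have h := congrArg (expect (iidList (poisson r) s)) (funext fun L : List ℕ => key L.sum)
  simp only [expect_add, expect_const, expect_const_mul, expect_iidList_poisson_sum,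
    expect_iidList_poisson_sum_sq] at h
  have hfin : (2 * (s * r) * (s * r) : ℝ≥0∞) ≠ ∞ := by
    refine ENNReal.mul_ne_top (ENNReal.mul_ne_top (by simp) ?_) ?_ <;>
      exact ENNReal.mul_ne_top (ENNReal.natCast_ne_top _) ENNReal.coe_ne_top
  refine (ENNReal.add_left_inj hfin).1 (h.trans ?_)
  ring

end Poisson

/-! ### The number of layers -/

section Layers

variable {n k : ℕ} {α β : ℝ} {d : Fin n → ℕ}

theorem numLayers_mul_le (hα : α < 1) (hβ : 0 < β) :
    (numLayers k α β d : ℝ) * β ≤ (1 - α) * ((∑ x, d x : ℕ) / k) := by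
  have h := Nat.floor_le (show 0 ≤ (1 - α) * β⁻¹ * (k : ℝ)⁻¹ * ((∑ x, d x : ℕ) : ℝ) by
    have : 0 ≤ 1 - α := by linarith
    positivity)
  calc (numLayers k α β d : ℝ) * β
      ≤ (1 - α) * β⁻¹ * (k : ℝ)⁻¹ * ((∑ x, d x : ℕ) : ℝ) * β :=
        mul_le_mul_of_nonneg_right h hβ.le
    _ = (1 - α) * ((∑ x, d x : ℕ) / k) * (β⁻¹ * β) := by ring
    _ = _ := by rw [inv_mul_cancel₀ hβ.ne', mul_one]

theorem le_numLayers_mul_add (hβ : 0 < β) :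
    (1 - α) * ((∑ x, d x : ℕ) / k) ≤ (numLayers k α β d : ℝ) * β + β := by
  have h := (Nat.lt_floor_add_one ((1 - α) * β⁻¹ * (k : ℝ)⁻¹ * ((∑ x, d x : ℕ) : ℝ))).le
  calc (1 - α) * ((∑ x, d x : ℕ) / k)
      = (1 - α) * ((∑ x, d x : ℕ) / k) * (β⁻¹ * β) := by rw [inv_mul_cancel₀ hβ.ne', mul_one]
    _ = (1 - α) * β⁻¹ * (k : ℝ)⁻¹ * ((∑ x, d x : ℕ) : ℝ) * β := by ring
    _ ≤ (numLayers k α β d + 1) * β := mul_le_mul_of_nonneg_right h hβ.le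
    _ = _ := by ring

theorem numChecks_le : (numChecks k d : ℝ) ≤ (∑ x, d x : ℕ) / k := Nat.cast_div_le

theorem coe_mul_toNNReal (s : ℕ) (β : ℝ) :
    (s * β.toNNReal : ℝ≥0∞) = ENNReal.ofReal (s * β) := by
  rw [ENNReal.ofReal_mul (by positivity), ENNReal.ofReal_natCast]
  rfl

theorem expect_sq_sub_le (hα : 0 < α) (hα' : α < 1) (hβ : 0 < β) :
    expect (iidList (poisson β.toNNReal) (numLayers k α β d))
      (fun ms => ENNReal.ofReal (((ms.sum : ℝ) - numLayers k α β d * β) ^ 2))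
      ≤ ENNReal.ofReal ((∑ x, d x : ℕ) / k) := by
  have h := expect_iidList_poisson_variance β.toNNReal (numLayers k α β d)
  rw [Real.coe_toNNReal _ hβ.le] at h
  rw [h, coe_mul_toNNReal]
  refine ENNReal.ofReal_le_ofReal ((numLayers_mul_le hα' hβ).trans ?_)
  have : (0 : ℝ) ≤ (∑ x, d x : ℕ) / k := by positivity
  nlinarith

variable [NeZero n]

theorem multiPoisson_eq :
    multiPoisson k α β d = (iidList (poisson β.toNNReal) (numLayers k α β d)).bind fun ms =>
      layeredGraph k ms d := by
  rw [multiPoisson, ← iid_map_ofFn, PMF.bind_map]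
  rfl

theorem multiPoisson_bind_missingChecks :
    ((multiPoisson k α β d).bind fun q => (missingChecks k d q).map fun A => (q.1, A)) =
      (iidList (poisson β.toNNReal) (numLayers k α β d)).bind fun ms =>
        completedGraph k ms (numChecks k d) d := by
  rw [multiPoisson_eq, PMF.bind_bind]
  rfl

/-- The comparison of the completed multi-Poisson approximation with the configuration model. -/
theorem coupled_multiPoisson (hk : k ≠ 0) (hα : 0 < α) (hα' : α < 1) (hβ : 0 < β) :
    Coupled (fun q F => listDiff (q.1 ++ q.2) F)
      ((multiPoisson k α β d).bind fun q => (missingChecks k d q).map fun A => (q.1, A))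
      (configModel k d) (ENNReal.ofReal (6 * k * (1 + β) / α + 2 / α + 12 / α ^ 2)) := by
  rw [multiPoisson_bind_missingChecks]
  have hM : numChecks k d * k ≤ ∑ x, d x := Nat.div_mul_le_self _ _
  have hk' : (0 : ℝ) < k := by exact_mod_cast Nat.pos_of_ne_zero hk
  -- Without sockets there are no layers; this case is split off because `T` appears in
  -- denominators.
  by_cases hS : ∑ x, d x = 0
  · have h0 : numLayers k α β d = 0 := by simp [numLayers, hS]
    rw [h0, iidList, PMF.pure_bind]
    exact (coupled_completedGraph (b := 0) (by simp) hM (by simp)).mono (by simp)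
  have hS' : (0 : ℝ) < (∑ x, d x : ℕ) := by exact_mod_cast Nat.pos_of_ne_zero hS
  rw [configModel, ← PMF.bind_const (iidList (poisson β.toNNReal) (numLayers k α β d))
    (configChecks k (numChecks k d) d)]
  have hc := numLayers_mul_le (k := k) (d := d) hα' hβ
  have hvar := expect_sq_sub_le (k := k) (d := d) hα hα' hβ
  have hMS := numChecks_le (k := k) (d := d)
  have hdiv : (∑ x, d x : ℕ) / (k : ℝ) * k = (∑ x, d x : ℕ) := div_mul_cancel₀ _ hk'.ne'
  set S : ℝ := ((∑ x, d x : ℕ) : ℝ) with hSdef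
  set s := numLayers k α β d
  set T := S / k with hT
  have hTpos : 0 < T := by positivity
  -- About αS sockets are expected to survive all layers; half of them are demanded.
  set b : ℕ := ⌈α * S / 2⌉₊ with hb
  have hbpos : (0 : ℝ) < b := lt_of_lt_of_le (by positivity) (Nat.le_ceil (α * S / 2))
  set K : ℝ := 2 / (α * T) + 3 * T * (4 / (α * T) ^ 2) with hK
  -- The first summand pays for layer sizes that leave `b` sockets, the second for all others.
  refine Coupled.bind_same (g := fun ms : List ℕ =>
    (ms.map fun m : ℕ => 3 * ((m * k : ℕ) ^ 2 * (b : ℝ≥0∞)⁻¹)).sum +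
      ENNReal.ofReal K * ENNReal.ofReal (((ms.sum : ℝ) - s * β) ^ 2)) ?_ fun ms _ => ?_
  · rw [expect_add, expect_const_mul, expect_iidList_sum_map]
    have e1 : ∀ m : ℕ, (3 * ((m * k : ℕ) ^ 2 * (b : ℝ≥0∞)⁻¹) : ℝ≥0∞) =
        (3 * k ^ 2 * (b : ℝ≥0∞)⁻¹) * (m : ℝ≥0∞) ^ 2 := fun m => by
      push_cast
      ring
    simp only [e1, expect_const_mul, expect_poisson_sq]
    have e2 : (s * (3 * k ^ 2 * (b : ℝ≥0∞)⁻¹ * (β.toNNReal + β.toNNReal ^ 2)) : ℝ≥0∞)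
        = ENNReal.ofReal (s * (3 * k ^ 2 * (b : ℝ)⁻¹ * (β + β ^ 2))) := by
      rw [ENNReal.ofReal_mul (by positivity), ENNReal.ofReal_mul (by positivity),
        ENNReal.ofReal_mul (by positivity), ENNReal.ofReal_mul (by positivity),
        ENNReal.ofReal_add (by positivity) (by positivity), ENNReal.ofReal_pow hβ.le,
        ENNReal.ofReal_inv_of_pos hbpos, ENNReal.ofReal_pow (by positivity)]
      simp [ENNReal.ofReal]
    have hKpos : 0 ≤ K := by positivity
    rw [e2]
    refine (add_le_add le_rfl (mul_le_mul_right hvar _)).trans ?_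
    rw [← ENNReal.ofReal_mul hKpos, ← ENNReal.ofReal_add (by positivity) (by positivity)]
    refine ENNReal.ofReal_le_ofReal ?_
    have h1 : K * T = 2 / α + 12 / α ^ 2 := by
      rw [hK]
      field_simp
      norm_num
    have h2 : (b : ℝ)⁻¹ ≤ 2 / (α * S) := by
      rw [inv_le_comm₀ hbpos (by positivity), inv_div]
      exact Nat.le_ceil _
    have h3 : s * (3 * k ^ 2 * (b : ℝ)⁻¹ * (β + β ^ 2)) ≤ 6 * k * (1 + β) / α := by
      calc s * (3 * k ^ 2 * (b : ℝ)⁻¹ * (β + β ^ 2))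
          = (s * β) * (3 * k ^ 2 * (1 + β)) * (b : ℝ)⁻¹ := by ring
        _ ≤ T * (3 * k ^ 2 * (1 + β)) * (2 / (α * S)) := by
            gcongr
            nlinarith
        _ = 6 * k * (1 + β) / α := by
            rw [hT]
            field_simp
            ring
    linarith
  · by_cases hgood : (ms.sum : ℝ) * k + α * S / 2 ≤ S
    · have hb' : b + ms.sum * k ≤ ∑ x, d x := by
        have h1 : ms.sum * k ≤ ∑ x, d x := by
          have : (ms.sum : ℝ) * k ≤ S := by
            have : 0 ≤ α * S / 2 := by positivity
            linarith
          rw [hSdef] at this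
          exact_mod_cast this
        have h2 : b ≤ ∑ x, d x - ms.sum * k := by
          rw [hb, Nat.ceil_le, Nat.cast_sub h1, ← hSdef, Nat.cast_mul]
          linarith
        omega
      refine (coupled_completedGraph ?_ hM hb').mono le_self_add
      rw [numChecks, Nat.le_div_iff_mul_le (Nat.pos_of_ne_zero hk)]
      omega
    · refine (coupled_completedGraph_trivial _ _ _).mono ?_
      refine le_trans ?_ le_add_self
      rw [← ENNReal.ofReal_mul (by positivity), ← ENNReal.ofReal_natCast]
      refine ENNReal.ofReal_le_ofReal ?_
      rw [Nat.cast_add, Nat.cast_mul, Nat.cast_ofNat]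
      -- Too few sockets left means N > (1 - α/2)T, whereas sβ ≤ (1-α)T. This lower bound on `y`
      -- lets both `y` and 1 be dominated by multiples of `y ^ 2`, which is where `K` comes from.
      have h1 : α * T / 2 ≤ ms.sum - s * β := by
        rw [not_le, ← hdiv] at hgood
        have : T * k < (ms.sum + α * T / 2) * k := by
          calc T * k < _ := hgood
            _ = _ := by ring
        have := lt_of_mul_lt_mul_right this hk'.le
        nlinarith
      set y := (ms.sum : ℝ) - s * β with hy
      have hh : 0 < α * T / 2 := by positivity
      have h2 : y ≤ 2 / (α * T) * y ^ 2 := by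
        rw [div_mul_eq_mul_div, le_div_iff₀ (by positivity)]
        nlinarith
      have h3 : 1 ≤ 4 / (α * T) ^ 2 * y ^ 2 := by
        rw [div_mul_eq_mul_div, le_div_iff₀ (by positivity)]
        nlinarith
      calc (ms.sum : ℝ) + 2 * numChecks k d ≤ y + 3 * T * 1 := by
            nlinarith
        _ ≤ 2 / (α * T) * y ^ 2 + 3 * T * (4 / (α * T) ^ 2 * y ^ 2) := by gcongr
        _ = K * y ^ 2 := by
            rw [hK]
            ring

end Layers

/-! ### The number of missing check nodes -/

section Missing

variable {n k Δ : ℕ} {α β : ℝ} {d : Fin n → ℕ}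

theorem sum_div_le (hk : k ≠ 0) (hd : ∑ x, d x ≤ Δ * n) :
    ((∑ x, d x : ℕ) : ℝ) / k ≤ Δ * n := by
  have : (1 : ℝ) ≤ k := by exact_mod_cast Nat.one_le_iff_ne_zero.2 hk
  exact (div_le_self (Nat.cast_nonneg _) this).trans (by exact_mod_cast hd)

/-- M ≤ T and sβ ≥ (1-α)T - β, the last β being lost to the floor in `numLayers`; moreover T ≤ Δn.
-/
theorem missing_le (hk : k ≠ 0) (hα : 0 < α) (hβ : 0 < β) (hd : ∑ x, d x ≤ Δ * n) (N : ℕ) :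
    ((numChecks k d - N : ℕ) : ℝ) ≤ α * Δ * n + β + |(N : ℝ) - numLayers k α β d * β| := by
  have h0 : (0 : ℝ) ≤ α * Δ * n + β := by positivity
  rcases le_total (numChecks k d) N with h | h
  · rw [Nat.sub_eq_zero_of_le h, Nat.cast_zero]
    positivity
  · rw [Nat.cast_sub h]
    have h1 := numChecks_le (k := k) (d := d)
    have h2 := le_numLayers_mul_add (k := k) (α := α) (d := d) hβ
    have h3 := neg_abs_le ((N : ℝ) - numLayers k α β d * β)
    have h4 := sum_div_le hk hd
    nlinarith

/-- In the constant Δ + 2, the share Δ is the deliberately omitted fraction α, one αn comes from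
splitting the fluctuation, and the other absorbs β and the variance term Δ/α. -/
theorem expect_missing_le (hk : k ≠ 0) (hα : 0 < α) (hα' : α < 1) (hβ : 0 < β) (hn : n ≠ 0)
    (hd : ∑ x, d x ≤ Δ * n) (hlarge : β + Δ / α ≤ α * n) :
    expect (iidList (poisson β.toNNReal) (numLayers k α β d))
      (fun ms => ((numChecks k d - ms.sum : ℕ) : ℝ≥0∞))
      ≤ ENNReal.ofReal ((Δ + 2) * α * n) := by
  have hn' : (0 : ℝ) < n := by exact_mod_cast Nat.pos_of_ne_zero hn
  calc _ ≤ expect (iidList (poisson β.toNNReal) (numLayers k α β d)) (fun ms =>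
          ENNReal.ofReal (α * Δ * n + β + α * n) + ENNReal.ofReal (1 / (α * n)) *
            ENNReal.ofReal (((ms.sum : ℝ) - numLayers k α β d * β) ^ 2)) := by
        refine expect_mono fun ms => ?_
        rw [← ENNReal.ofReal_mul (by positivity), ← ENNReal.ofReal_add (by positivity)
          (by positivity), ← ENNReal.ofReal_natCast]
        refine ENNReal.ofReal_le_ofReal ((missing_le hk hα hβ hd ms.sum).trans ?_)
        -- The elementary bound y ≤ h + y²/h with h = αn brings in the variance.
        have : |(ms.sum : ℝ) - numLayers k α β d * β| ≤ α * n +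
            1 / (α * n) * ((ms.sum : ℝ) - numLayers k α β d * β) ^ 2 := by
          rw [← sq_abs]
          generalize |(ms.sum : ℝ) - numLayers k α β d * β| = y
          have hh : 0 < α * n := by positivity
          rw [← sub_nonneg]
          have : α * n + 1 / (α * n) * y ^ 2 - y
              = ((α * n - y / 2) ^ 2 + 3 / 4 * y ^ 2) / (α * n) := by
            field_simp
            ring
          rw [this]
          positivity
        linarith
    _ ≤ ENNReal.ofReal (α * Δ * n + β + α * n) + ENNReal.ofReal (1 / (α * n)) *
          ENNReal.ofReal (Δ * n) := by
        rw [expect_add, expect_const, expect_const_mul]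
        gcongr
        exact (expect_sq_sub_le hα hα' hβ).trans (ENNReal.ofReal_le_ofReal (sum_div_le hk hd))
    _ ≤ _ := by
        rw [← ENNReal.ofReal_mul (by positivity), ← ENNReal.ofReal_add (by positivity)
          (by positivity)]
        refine ENNReal.ofReal_le_ofReal ?_
        have : 1 / (α * n) * (Δ * n) = Δ / α := by field_simp
        rw [this]
        linarith

/-- Chebyshev: once β ≤ αn, an excess forces N to deviate from sβ by at least αn, which has
probability at most Δ/(α²n). -/
theorem expect_missing_indicator_le (hk : k ≠ 0) (hα : 0 < α) (hα' : α < 1) (hβ : 0 < β)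
    (hn : n ≠ 0) {η : ℝ} (hη : 0 < η) (hd : ∑ x, d x ≤ Δ * n) (hlarge : β ≤ α * n)
    (hlarge' : Δ / (α ^ 2 * η) ≤ n) :
    expect (iidList (poisson β.toNNReal) (numLayers k α β d))
      (fun ms => {l : ℕ | (Δ + 2) * α * n < (l : ℝ)}.indicator 1 (numChecks k d - ms.sum))
      ≤ ENNReal.ofReal η := by
  have hn' : (0 : ℝ) < n := by exact_mod_cast Nat.pos_of_ne_zero hn
  calc _ ≤ expect (iidList (poisson β.toNNReal) (numLayers k α β d)) (fun ms =>
          ENNReal.ofReal (1 / (α * n) ^ 2) *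
            ENNReal.ofReal (((ms.sum : ℝ) - numLayers k α β d * β) ^ 2)) := by
        refine expect_mono fun ms => Set.indicator_apply_le' (fun h => ?_) fun _ => zero_le
        rw [← ENNReal.ofReal_mul (by positivity), Pi.one_apply, ← ENNReal.ofReal_one]
        refine ENNReal.ofReal_le_ofReal ?_
        have h1 := missing_le hk hα hβ hd ms.sum
        rw [Set.mem_ofPred_eq] at h
        rw [← sq_abs ((ms.sum : ℝ) - _), one_div, ← div_eq_inv_mul, one_le_div (by positivity)]
        refine pow_le_pow_left₀ (by positivity) ?_ 2
        linarith
    _ ≤ ENNReal.ofReal (1 / (α * n) ^ 2) * ENNReal.ofReal (Δ * n) := by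
        rw [expect_const_mul]
        gcongr
        exact (expect_sq_sub_le hα hα' hβ).trans (ENNReal.ofReal_le_ofReal (sum_div_le hk hd))
    _ ≤ _ := by
        rw [← ENNReal.ofReal_mul (by positivity)]
        refine ENNReal.ofReal_le_ofReal ?_
        rw [div_le_iff₀ (by positivity)] at hlarge'
        rw [one_div, ← div_eq_inv_mul, div_le_iff₀ (by positivity)]
        nlinarith

end Missing

/-! ### The teacher-student model -/

section Teacher

variable {Ω : Type*} {k n Δ : ℕ}

theorem map_fst_of_mem_support_attachWeights {W : WeightModel Ω k} {σ : Fin n → Ω}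
    {F : List (Fin k → Fin n)} {G : List (CheckNode W n)}
    (h : G ∈ (attachWeights W σ F).support) : G.map Prod.fst = F := by
  induction F generalizing G with
  | nil =>
    rw [attachWeights, PMF.mem_support_pure_iff] at h
    simp [h]
  | cons a F ih =>
    simp only [attachWeights, PMF.mem_support_bind_iff, PMF.mem_support_pure_iff] at h
    obtain ⟨ψ, _, G', hG', rfl⟩ := h
    simp [ih hG']

theorem length_of_mem_support_attachWeights {W : WeightModel Ω k} {σ : Fin n → Ω}
    {F : List (Fin k → Fin n)} {G : List (CheckNode W n)}
    (h : G ∈ (attachWeights W σ F).support) : G.length = F.length := by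
  rw [← map_fst_of_mem_support_attachWeights h, List.length_map]

theorem sum_le_of_mem_support_degreeLaw {D : PMF (Fin (Δ + 1))}
    {h : (degreeSequences D n).Nonempty} {d : Fin n → ℕ} (hd : d ∈ (degreeLaw D h).support) :
    ∑ x, d x ≤ Δ * n := by
  rw [degreeLaw, PMF.mem_support_map_iff] at hd
  obtain ⟨d', -, rfl⟩ := hd
  calc ∑ x, (d' x : ℕ) ≤ ∑ _x : Fin n, Δ :=
        Finset.sum_le_sum fun x _ => Nat.lt_succ_iff.1 (d' x).2
    _ = Δ * n := by simp [mul_comm]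

variable [Fintype Ω] [Nonempty Ω] [NeZero n]

/-- Given the ground truth, the weights of the approximation do not influence the missing check
nodes, so all weights can be attached at the end. -/
theorem approxGraphWithMissing_eq (W : WeightModel Ω k) (D : PMF (Fin (Δ + 1)))
    (h : (degreeSequences D n).Nonempty) (α β : ℝ) :
    approxGraphWithMissing W D h α β =
      (PMF.uniformOfFintype (Fin n → Ω)).bind fun σ => (degreeLaw D h).bind fun d =>
        ((multiPoisson k α β d).bind fun q => (missingChecks k d q).map fun A => (q.1, A)).bind
          fun p => (attachWeights W σ p.1).bind fun G => (attachWeights W σ p.2).map fun B =>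
            (G, B) := by
  rw [approxGraphWithMissing]
  refine congrArg _ (funext fun σ => congrArg _ (funext fun d => ?_))
  rw [PMF.bind_bind]
  refine congrArg _ (funext fun q => ?_)
  rw [PMF.bind_map, PMF.bind_comm]
  rfl

/-- Both graphs share the ground truth and the degree sequence; the weights may be coupled
independently because the cost ignores them. -/
theorem coupled_approxGraphWithMissing (W : WeightModel Ω k) (D : PMF (Fin (Δ + 1)))
    (h : (degreeSequences D n).Nonempty) {α β : ℝ} (hk : k ≠ 0) (hα : 0 < α) (hα' : α < 1)
    (hβ : 0 < β) :
    Coupled (fun p G => (numDifferent (p.1 ++ p.2) G : ℝ≥0∞)) (approxGraphWithMissing W D h α β)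
      (exactGraph W D h) (ENNReal.ofReal (6 * k * (1 + β) / α + 2 / α + 12 / α ^ 2)) := by
  rw [approxGraphWithMissing_eq, exactGraph]
  refine Coupled.bind_same_const fun σ _ => Coupled.bind_same_const fun d _ => ?_
  refine (coupled_multiPoisson hk hα hα' hβ).bind fun p _ F _ =>
    coupled_of_forall _ _ fun GB hGB G' hG' => ?_
  simp only [PMF.mem_support_bind_iff, PMF.mem_support_map_iff] at hGB
  obtain ⟨G, hG, B, hB, rfl⟩ := hGB
  rw [numDifferent_eq_listDiff, List.map_append, map_fst_of_mem_support_attachWeights hG,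
    map_fst_of_mem_support_attachWeights hB, map_fst_of_mem_support_attachWeights hG']

/-- The number of missing check nodes is determined by the sizes of the layers. -/
theorem expect_length_missing (W : WeightModel Ω k) (D : PMF (Fin (Δ + 1)))
    (h : (degreeSequences D n).Nonempty) (α β : ℝ) (g : ℕ → ℝ≥0∞) :
    expect (approxGraphWithMissing W D h α β) (fun ω => g ω.2.length) =
      expect (degreeLaw D h) fun d =>
        expect (iidList (poisson β.toNNReal) (numLayers k α β d)) fun ms =>
          g (numChecks k d - ms.sum) := by
  have key : ∀ (σ : Fin n → Ω) (d : Fin n → ℕ), expect (multiPoisson k α β d) (fun q =>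
      expect (missingChecks k d q) fun A =>
        expect (attachWeights W σ A) fun B => g B.length) =
      expect (iidList (poisson β.toNNReal) (numLayers k α β d)) fun ms =>
        g (numChecks k d - ms.sum) := by
    intro σ d
    rw [multiPoisson_eq, expect_bind]
    refine congrArg _ (funext fun ms => ?_)
    rw [← expect_const (layeredGraph k ms d) (g (numChecks k d - ms.sum))]
    refine expect_congr_support fun q hq => ?_
    rw [← expect_const (missingChecks k d q) (g (numChecks k d - ms.sum))]
    refine expect_congr_support fun A hA => ?_
    rw [← expect_const (attachWeights W σ A) (g (numChecks k d - ms.sum))]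
    refine expect_congr_support fun B hB => ?_
    rw [length_of_mem_support_attachWeights hB,
      length_of_mem_support_configChecks hA, length_of_mem_support_layeredGraph hq]
  simp only [approxGraphWithMissing, expect_bind, expect_pure, key, expect_const]

end Teacher

end FactorGraph

end

/-! ### The proposition -/

open FactorGraph in
theorem proposition2p2 {Ω : Type*} [Fintype Ω] [Nonempty Ω] (k : ℕ) (hk : 2 ≤ k)
    (W : WeightModel Ω k) (Δ : ℕ) (D : PMF (Fin (Δ + 1))) :
    ∃ (f : ℝ → ℝ → ℝ) (C : ℝ),
      -- `f` is bounded as long as `α` stays away from `0` and `β` from `∞`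
      (∀ ε B : ℝ, 0 < ε → 0 < B → ∃ K : ℝ, ∀ α β : ℝ,
        ε ≤ α → α < 1 → 0 < β → β ≤ B → |f α β| ≤ K) ∧
      ∀ α β : ℝ, 0 < α → α < 1 → 0 < β →
        -- the coupling
        (∀ (n : ℕ) [NeZero n] (h : (degreeSequences D n).Nonempty),
          ∃ μ : PMF ((List (CheckNode W n) × List (CheckNode W n)) × List (CheckNode W n)),
            μ.map (fun ω => ω.1.1) = approxGraph W D h α β ∧
            μ.map (fun ω => ω.1) = approxGraphWithMissing W D h α β ∧
            μ.map (fun ω => ω.2) = exactGraph W D h ∧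
            expect μ (fun ω => (numDifferent (ω.1.1 ++ ω.1.2) ω.2 : ℝ≥0∞))
              ≤ ENNReal.ofReal (f α β)) ∧
        -- `O(α n)` check nodes are missing, in expectation and with high probability
        (∃ n₀ : ℕ, ∀ (n : ℕ) [NeZero n] (h : (degreeSequences D n).Nonempty), n₀ ≤ n →
          expect (approxGraphWithMissing W D h α β) (fun ω => (ω.2.length : ℝ≥0∞))
            ≤ ENNReal.ofReal (C * α * n)) ∧
        (∀ η : ℝ, 0 < η → ∃ n₀ : ℕ,
          ∀ (n : ℕ) [NeZero n] (h : (degreeSequences D n).Nonempty), n₀ ≤ n →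
            (approxGraphWithMissing W D h α β).toOuterMeasure
              {ω | C * α * n < (ω.2.length : ℝ)} ≤ ENNReal.ofReal η) := by
  have hk0 : k ≠ 0 := by omega
  refine ⟨fun α β => 6 * k * (1 + β) / α + 2 / α + 12 / α ^ 2, Δ + 2, ?_, ?_⟩
  · intro ε B hε hB
    -- The bound is the value at (ε, B), since `f` decreases in α and increases in β.
    refine ⟨6 * k * (1 + B) / ε + 2 / ε + 12 / ε ^ 2, fun α β hα _ hβ hβB => ?_⟩
    have hα0 : 0 < α := hε.trans_le hα
    beta_reduce
    rw [abs_of_nonneg (by positivity)]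
    gcongr
  · intro α β hα hα' hβ
    refine ⟨fun n _ h => ?_, ?_, ?_⟩
    · obtain ⟨μ, h1, h2, h3⟩ := coupled_approxGraphWithMissing W D h hk0 hα hα' hβ
      refine ⟨μ, ?_, h1, h2, h3⟩
      rw [← map_fst_approxGraphWithMissing, ← h1, PMF.map_comp]
      rfl
    · refine ⟨⌈(β + Δ / α) / α⌉₊, fun n _ h hn => ?_⟩
      rw [expect_length_missing W D h α β fun l => (l : ℝ≥0∞)]
      refine expect_le_of_support fun d hd => expect_missing_le hk0 hα hα' hβ (NeZero.ne n)
        (sum_le_of_mem_support_degreeLaw hd) ?_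
      rw [Nat.ceil_le, div_le_iff₀ hα] at hn
      linarith
    · intro η hη
      refine ⟨max ⌈β / α⌉₊ ⌈Δ / (α ^ 2 * η)⌉₊, fun n _ h hn => ?_⟩
      rw [max_le_iff, Nat.ceil_le, Nat.ceil_le, div_le_iff₀ hα] at hn
      rw [toOuterMeasure_eq_expect]
      refine (expect_length_missing W D h α β
        ({l : ℕ | ((Δ : ℝ) + 2) * α * n < (l : ℝ)}.indicator 1)).trans_le ?_
      exact expect_le_of_support fun d hd => expect_missing_indicator_le hk0 hα hα' hβ
        (NeZero.ne n) hη (sum_le_of_mem_support_degreeLaw hd) (by linarith [hn.1]) hn.2
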